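/- Let $q\equiv 1\pmod 4$ be a prime power, $K=\mathbb F_{q^2}$, $L=\mathbb F_{q^4}$, $n=q^2+1$, and let $\mathcal U_n=\{u\in L: u^n=1\}$. Let $\delta\in L$ have order $2n$, and let $N_+=C(1,q^2+q+1)$ be the negacyclic code of length $n$ over $K$ whose check polynomial is the product of the minimal polynomials over $K$ of $\delta$ and $\delta^{q^2+q+1}$. For $c\in N_+$ put $Z(c)=\{i: c_i=0\}$ and $\operatorname{supp}(c)=\{i:c_i\neq0\}$; the minimum words are the nonzero codewords of least weight. Identify the coordinate $i\in\{0,\dots,n-1\}$ with $x=\delta^{-i}$. Let $\omega\in L^*$ satisfy $\omega^{q^2}=-\omega$, and put $\Theta_\omega(t)=\frac{t+\omega}{t-\omega}$ for $t\in K$, $\Theta_\omega(\infty)=1$. A Baer subline of $\operatorname{PG}(1,q^2)=K\cup\{\infty\}$ is an image of $\operatorname{PG}(1,q)$ under an element of $\operatorname{PGL}(2,K)$; the Miquelian inversive plane $\mathsf I(q)$ has the points of $\operatorname{PG}(1,q^2)$ as points and the Baer sublines as blocks. The complement of an incidence structure is obtained by replacing every block by its complement in the point set. Then: 1. The transport $i\mapsto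 x^{q+1}=\delta^{-i(q+1)}$ is a bijection from $\{0,\dots,n-1\}$ onto $\mathcal U_n$, $\Theta_\omega$ is a bijection from $\operatorname{PG}(1,q^2)$ onto $\mathcal U_n$, and $N_+$ has minimum distance $q^2-q$. 2. The minimum zero sets $Z(c)$, transported to $\mathcal U_n$, are exactly the sets $\Theta_\omega(B)$ with $B$ a Baer subline of $\operatorname{PG}(1,q^2)$. Equivalently, the transported minimum supports are exactly the sets $\mathcal U_n\setminus\Theta_\omega(B)$. 3. Let $\zeta\in K^*$ with $\zeta^q=-\zeta$, and $\mu=\zeta^2\in\mathbb F_q$. Then the quadric $\mathcal Q^-(3,q)$ with equation $X_0X_3=X_1^2-\mu X_2^2$ in $\operatorname{PG}(3,q)$ is elliptic (its form is nondegenerate, and the quadric has a point but contains no line), and $\iota(x+y\zeta)=\langle(1,x,y,(x+y\zeta)^{q+1})\rangle$ $(x,y\in\mathbb F_q)$, $\iota(\infty)=\langle(0,0,0,1)\rangle$ defines a bijection from $\operatorname{PG}(1,q^2)$ onto $\mathcal Q^-(3,q)$. 4. The transport followed by $\Theta_\omega^{-1}$ is an isomorphism from the minimum-support design of $N_+$ onto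 the complement of $\mathsf I(q)$, and $\iota$ is an isomorphism from the complement of $\mathsf I(q)$ onto the structure on $\mathcal Q^-(3,q)$ with blocks $$\mathcal Q^-(3,q)\setminus(\Pi\cap\mathcal Q^-(3,q)),\qquad \Pi\text{ a non-tangent plane};$$ so their composite is an isomorphism from the minimum-support design of $N_+$ onto the latter structure. Here a plane is tangent if it is the polar plane of a point of the quadric. 5. The blocks in 4 are also exactly the minimum supports of the code $\{aG:a\in\mathbb F_q^4\}$, where $G$ is any matrix whose columns are coordinate vectors of the points of $\mathcal Q^-(3,q)$, one for each point. -/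

import Mathlib

open Polynomial

/-! ### Linear codes, minimum distance, supports and zero sets -/

/-- The Hamming weight of a word: the number of its non-zero coordinates. -/
noncomputable def wordWeight {ι K : Type*} [Zero K] (c : ι → K) : ℕ :=
  (Function.support c).ncard

/-- The minimum distance of a linear code: the least weight of a non-zero codeword. -/
noncomputable def minDistance {ι K : Type*} [Field K] (C : Submodule K (ι → K)) : ℕ :=
  sInf {w | ∃ c ∈ C, c ≠ 0 ∧ wordWeight c = w}

/-- The set of minimum words of a linear code: the non-zero codewords of least weight. -/
def minWords {ι K : Type*} [Field K] (C : Submodule K (ι → K)) : Set (ι → K) :=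
  {c | c ∈ C ∧ c ≠ 0 ∧ wordWeight c = minDistance C}

/-- The minimum supports of a code: the supports of its minimum words. -/
def minSupports {ι K : Type*} [Field K] (C : Submodule K (ι → K)) : Set (Set ι) :=
  {S | ∃ c ∈ minWords C, S = Function.support c}

/-- The minimum zero sets of a code: the sets `Z(c) = {i | c i = 0}` of its minimum words. -/
def minZeroSets {ι K : Type*} [Field K] (C : Submodule K (ι → K)) : Set (Set ι) :=
  {Z | ∃ c ∈ minWords C, Z = {i | c i = 0}}

/-! ### Negacyclic codes -/

/-- The polynomial `c₀ + c₁ X + ⋯ + c_{n-1} X^{n-1}` of a word. -/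
noncomputable def wordPolynomial {K : Type*} [Field K] {n : ℕ} (c : Fin n → K) : K[X] :=
  ∑ i : Fin n, C (c i) * X ^ (i : ℕ)

/-- The negacyclic code of length `n` over `K` with check polynomial `h` (a divisor of `X ^ n + 1`):
the words `c` whose polynomial is annihilated by `h` modulo `X ^ n + 1`. -/
noncomputable def negacyclicCode {K : Type*} [Field K] (n : ℕ) (h : K[X]) :
    Submodule K (Fin n → K) where
  carrier := {c | X ^ n + 1 ∣ h * wordPolynomial c}
  zero_mem' := by simp [wordPolynomial]
  add_mem' := by
    intro a b ha hb
    have hab : wordPolynomial (a + b) = wordPolynomial a + wordPolynomial b := by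
      simp [wordPolynomial, add_mul, Finset.sum_add_distrib]
    simp only [Set.mem_ofPred_eq] at ha hb ⊢
    rw [hab, mul_add]
    exact dvd_add ha hb
  smul_mem' := by
    intro r a ha
    have hra : wordPolynomial (r • a) = C r * wordPolynomial a := by
      simp [wordPolynomial, Finset.mul_sum, mul_assoc]
    simp only [Set.mem_ofPred_eq] at ha ⊢
    rw [hra, mul_left_comm]
    exact Dvd.dvd.mul_left ha _

/-- If `h * g = X ^ n + 1`, then the code with check polynomial `h` is the ideal of
`K[X] / (X ^ n + 1)` with generator polynomial `g`. -/
theorem mem_negacyclicCode_iff_generator_dvd {K : Type*} [Field K] {n : ℕ} {h g : K[X]}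
    (hg : h * g = X ^ n + 1) (h0 : h ≠ 0) (c : Fin n → K) :
    c ∈ negacyclicCode n h ↔ g ∣ wordPolynomial c := by
  change X ^ n + 1 ∣ h * wordPolynomial c ↔ _
  rw [← hg]
  exact mul_dvd_mul_iff_left h0

/-- `C(i, j)`: the negacyclic code of length `n` over `K` whose check polynomial is the product of
the minimal polynomials over `K` of `δ ^ i` and `δ ^ j`; here `δ` has order `2n`. -/
noncomputable def negacyclicCodeC (K : Type*) {L : Type*} [Field K] [Field L] [Algebra K L]
    (n : ℕ) (δ : L) (i j : ℕ) : Submodule K (Fin n → K) :=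
  negacyclicCode n (minpoly K (δ ^ i) * minpoly K (δ ^ j))

/-! ### Incidence structures -/

/-- An incidence structure (a simple block system) on the point set `V`. -/
structure IncidenceStructure (V : Type*) where
  /-- the blocks -/
  blocks : Set (Set V)

/-- The complementary structure: the blocks are replaced by their complements. -/
def IncidenceStructure.complement {V : Type*} (D : IncidenceStructure V) :
    IncidenceStructure V :=
  ⟨{S | ∃ B ∈ D.blocks, S = Bᶜ}⟩

/-- The bijection `e` of point sets is an isomorphism: it maps the blocks of `D` exactly onto the
blocks of `E`. -/
def IncidenceStructure.IsIso {V W : Type*} (e : V ≃ W) (D : IncidenceStructure V)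
    (E : IncidenceStructure W) : Prop :=
  {T | ∃ B ∈ D.blocks, T = e '' B} = E.blocks

/-- The minimum-support design of a code. -/
def minSupportDesign {ι K : Type*} [Field K] (C : Submodule K (ι → K)) : IncidenceStructure ι :=
  ⟨minSupports C⟩

/-! ### Sublines, the Miquelian plane and the Cayley map.  `PG(1, K)` is `OnePoint K`. -/

open Classical in
/-- The `F`-sublines of `PG(1, K)`: the images of `PG(1, F)` under `PGL(2, K)`, that is under
Möbius transformations.  They are called Baer sublines if `|K| = |F|²`. -/
def sublines (F K : Type*) [Field F] [Field K] [Algebra F K] : Set (Set (OnePoint K)) :=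
  {B | ∃ g : Matrix.GeneralLinearGroup (Fin 2) K,
    B = (fun x => g • x) '' Set.range (OnePoint.map (algebraMap F K))}

/-- The Miquelian inversive plane: the points of `PG(1, K)` and its `F`-sublines, `|K| = |F|²`. -/
def miquelianPlane (F K : Type*) [Field F] [Field K] [Algebra F K] :
    IncidenceStructure (OnePoint K) :=
  ⟨sublines F K⟩

/-- The group `U_n` of `n`-th roots of unity in `L`, as a set. -/
def unitCircle (L : Type*) [Field L] (n : ℕ) : Set L := {u | u ^ n = 1}

/-- The Cayley map `t ↦ (t + ω) / (t - ω)`, `∞ ↦ 1`. -/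
noncomputable def cayleyMap {K L : Type*} [Field K] [Field L] [Algebra K L] (ω : L)
    (t : OnePoint K) : L :=
  t.elim 1 fun x => (algebraMap K L x + ω) / (algebraMap K L x - ω)

/-- The coordinate transport: the coordinate `i`, that is the point `x = δ ^ (-i)`, is sent to
`x ^ (q + 1)`. -/
noncomputable def transport {L : Type*} [Field L] (q n : ℕ) (δ : L) (i : Fin n) : L :=
  ((δ⁻¹) ^ (i : ℕ)) ^ (q + 1)

/-! ### Quadrics in `PG(3, F)` -/

/-- The points of `PG(3, F)` on the quadric `Φ = 0`. -/
def quadric {F : Type*} [Field F] (Φ : QuadraticForm F (Fin 4 → F)) :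
    Set (Projectivization F (Fin 4 → F)) :=
  {P | Φ P.rep = 0}

/-- The quadric of `Φ` in `PG(3, F)` is elliptic: `Φ` is nondegenerate and of Witt index one, i.e.
the quadric has a point but contains no line. -/
def IsEllipticForm {F : Type*} [Field F] (Φ : QuadraticForm F (Fin 4 → F)) : Prop :=
  Φ.Nondegenerate ∧ (quadric Φ).Nonempty ∧
    ∀ W : Submodule F (Fin 4 → F), Module.finrank F W = 2 → ∃ v ∈ W, Φ v ≠ 0

/-- The form `X₀X₃ - (X₁² - μ X₂²)`. -/
def ellipticForm {F : Type*} [Field F] (μ : F) : QuadraticForm F (Fin 4 → F) :=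
  QuadraticMap.proj 0 3 - (QuadraticMap.proj 1 1 - μ • QuadraticMap.proj 2 2)

/-- The hyperplane `E` is tangent to the quadric of `Φ`: it is the polar hyperplane of one of the
points of the quadric. -/
def IsTangentPlane {F : Type*} [Field F] (Φ : QuadraticForm F (Fin 4 → F))
    (E : Submodule F (Fin 4 → F)) : Prop :=
  ∃ P ∈ quadric Φ, ∀ v, v ∈ E ↔ QuadraticMap.polar Φ P.rep v = 0

/-- The plane sections `E ∩ Q` of the quadric by the non-tangent planes `E` of `PG(3, F)`. -/
def planeSectionStructure {F : Type*} [Field F] (Φ : QuadraticForm F (Fin 4 → F)) :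
    IncidenceStructure (quadric Φ) :=
  ⟨{S | ∃ E : Submodule F (Fin 4 → F), Module.finrank F E = 3 ∧ ¬ IsTangentPlane Φ E ∧
    S = {P | P.1.submodule ≤ E}}⟩

/-- The code `{a G : a ∈ F⁴}` whose generator matrix `G` has the columns `g P`. -/
def columnCode {F ι : Type*} [Field F] (g : ι → Fin 4 → F) : Submodule F (ι → F) :=
  LinearMap.range (LinearMap.pi fun P => Fintype.linearCombination F (g P) :
    (Fin 4 → F) →ₗ[F] (ι → F))

/-!
The idea is to read all blocks as isotropic loci of sesquilinear forms
`A t σ(t) + B t + C σ(t) + D` on `PG(1, K)`, where `σ(t) = t ^ q`.  `PGL(2, K)` acts on these forms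
and is transitive on triples of points.  A non-zero form with three isotropic points can therefore
be moved to one for which `∞`, `0` and `1` are isotropic; that is a multiple of `t - σ(t)`, whose
isotropic points are those of `PG(1, F)`.  So the locus of a non-zero form has at most two points or
is a Baer subline (`ncard_zeroLocus_le_two_or_mem_sublines`), and every subline occurs, even for a
Hermitian form (`exists_hermitian_of_mem_sublines`).

A code whose non-zero words vanish exactly on such loci, with all sublines occurring, has minimum
distance `(q² + 1) - (q + 1)` and the sublines as minimum zero sets; `HasSublineZeros` records this
situation, and two codes are brought into it.

* For the negacyclic code the four roots of the check polynomial are `δ`, `δ ^ r` with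
  `r = q² + q + 1`, and their conjugates.  At `x = δ⁻ⁱ` the word
  `a x + a* x ^ q² + b x ^ r + b* x ^ (r q²)`, multiplied by `x ^ q`, is
  `a u + a* u ^ q + b u ^ (q + 1) + b*` with `u = x ^ (q + 1)` (`mul_word_eq_cayleyForm`), and the
  substitution `u = (t + ω) / (t - ω)` turns this into a sesquilinear form in `t`
  (`cayleyForm_eq_zero_iff`).  All forms arise from words, and all words from forms because a word
  is determined by four coordinates (`hasSublineZeros_negacyclicCodeC`).
* On the quadric, the polar form of a vector `p` at `ι t` is a Hermitian form in `t`, and all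
  Hermitian forms arise in this way.  This gives the code of the quadric
  (`QuadraticCoords.hasSublineZeros_columnCode`) and the plane sections
  (`QuadraticCoords.image_mem_planeSections_iff`).  A plane is tangent exactly if its pole `p` is on
  the quadric; then the form has a single isotropic point, and otherwise it has at least three by
  the surjectivity of the norm.
-/

/-! ### Sesquilinear forms on the projective line -/

section Sesquilinear

variable {K : Type*} [Field K]

/-- The value at `(v, v)` of the `σ`-sesquilinear form on `K²` with Gram matrix `M`. -/
def sesq (σ : K →+* K) (M : Matrix (Fin 2) (Fin 2) K) (v : Fin 2 → K) : K :=
  ∑ i, ∑ j, v i * M i j * σ (v j)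

/-- Homogeneous coordinates on `PG(1, K)`: `t ↦ (t, 1)` and `∞ ↦ (1, 0)`. -/
def homVec (x : OnePoint K) : Fin 2 → K :=
  x.elim ![1, 0] fun t => ![t, 1]

@[simp] lemma homVec_infty : homVec (OnePoint.infty : OnePoint K) = ![1, 0] := rfl

@[simp] lemma homVec_coe (t : K) : homVec (t : OnePoint K) = ![t, 1] := rfl

/-- The points of `PG(1, K)` that are isotropic for the sesquilinear form with Gram matrix `M`. -/
def zeroLocus (σ : K →+* K) (M : Matrix (Fin 2) (Fin 2) K) : Set (OnePoint K) :=
  {x | sesq σ M (homVec x) = 0}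

lemma infty_mem_zeroLocus {σ : K →+* K} {M : Matrix (Fin 2) (Fin 2) K} :
    OnePoint.infty ∈ zeroLocus σ M ↔ M 0 0 = 0 := by
  simp [zeroLocus, sesq, Fin.sum_univ_two]

lemma coe_mem_zeroLocus {σ : K →+* K} {M : Matrix (Fin 2) (Fin 2) K} {t : K} :
    (t : OnePoint K) ∈ zeroLocus σ M ↔
      M 0 0 * (t * σ t) + M 0 1 * t + M 1 0 * σ t + M 1 1 = 0 := by
  simp only [zeroLocus, sesq, Fin.sum_univ_two, homVec_coe, Set.mem_ofPred_eq, Matrix.cons_val_zero,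
    Matrix.cons_val_one, map_one]
  constructor <;> intro h <;> linear_combination h

lemma sesq_smul (σ : K →+* K) (M : Matrix (Fin 2) (Fin 2) K) (c : K) (v : Fin 2 → K) :
    sesq σ M (c • v) = c * σ c * sesq σ M v := by
  simp only [sesq, Fin.sum_univ_two, Pi.smul_apply, smul_eq_mul, map_mul]
  ring

open Matrix in
lemma sesq_mulVec (σ : K →+* K) (M g : Matrix (Fin 2) (Fin 2) K) (v : Fin 2 → K) :
    sesq σ M (g *ᵥ v) = sesq σ (gᵀ * M * g.map σ) v := by
  simp only [sesq, Fin.sum_univ_two, Matrix.mulVec_fin_two, Matrix.mul_apply, Matrix.transpose_apply,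
    Matrix.map_apply, map_add, map_mul, Matrix.cons_val_zero, Matrix.cons_val_one]
  ring

lemma homVec_ne_zero (x : OnePoint K) : homVec x ≠ 0 := by
  induction x using OnePoint.rec with
  | infty => intro h; simpa using congrFun h 0
  | coe t => intro h; simpa using congrFun h 1

lemma homVec_eq_of_smul {x y : OnePoint K} {c : K} (h : homVec x = c • homVec y) : x = y := by
  induction x using OnePoint.rec with
  | infty =>
    induction y using OnePoint.rec with
    | infty => rfl
    | coe s =>
      have h0 := congrFun h 0
      have h1 := congrFun h 1
      simp at h0 h1
      simp [← h1] at h0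
  | coe t =>
    induction y using OnePoint.rec with
    | infty => simpa using congrFun h 1
    | coe s =>
      have h0 := congrFun h 0
      have h1 := congrFun h 1
      simp at h0 h1
      simp [h0, ← h1]

open Classical in
/-- The action on points of `PG(1, K)` is the linear action on homogeneous coordinates. -/
lemma exists_mulVec_homVec (g : Matrix.GeneralLinearGroup (Fin 2) K) (x : OnePoint K) :
    ∃ c : K, c ≠ 0 ∧ g.1.mulVec (homVec x) = c • homVec (g • x) := by
  have key : g.1.mulVec (homVec x) ≠ 0 := fun h => homVec_ne_zero x <| by
    have := congrArg (g⁻¹).1.mulVec h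
    rwa [Matrix.mulVec_mulVec, ← Units.val_mul, inv_mul_cancel, Units.val_one, Matrix.one_mulVec,
      Matrix.mulVec_zero] at this
  suffices ∃ c : K, g.1.mulVec (homVec x) = c • homVec (g • x) by
    obtain ⟨c, hc⟩ := this
    exact ⟨c, by rintro rfl; simp [hc] at key, hc⟩
  induction x using OnePoint.rec with
  | infty =>
    rw [OnePoint.smul_infty_eq_ite]
    split_ifs with h
    · exact ⟨g.1 0 0, by ext i; fin_cases i <;> simp [h]⟩
    · exact ⟨g.1 1 0, by ext i; fin_cases i <;> simp [mul_div_cancel₀ _ h]⟩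
  | coe t =>
    rw [OnePoint.smul_some_eq_ite]
    split_ifs with h
    · exact ⟨g.1 0 0 * t + g.1 0 1, by ext i; fin_cases i <;> simp [h]⟩
    · exact ⟨g.1 1 0 * t + g.1 1 1, by ext i; fin_cases i <;> simp [mul_div_cancel₀ _ h]⟩

/-- The Gram matrix of the form `v ↦ h (g v)`, where `h` has Gram matrix `M`. -/
def pullbackGram (σ : K →+* K) (g : Matrix.GeneralLinearGroup (Fin 2) K)
    (M : Matrix (Fin 2) (Fin 2) K) : Matrix (Fin 2) (Fin 2) K :=
  g.1.transpose * M * g.1.map σ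

open Classical in
lemma smul_mem_zeroLocus {σ : K →+* K} {M : Matrix (Fin 2) (Fin 2) K}
    {g : Matrix.GeneralLinearGroup (Fin 2) K} {x : OnePoint K} :
    g • x ∈ zeroLocus σ M ↔ x ∈ zeroLocus σ (pullbackGram σ g M) := by
  obtain ⟨c, hc, h⟩ := exists_mulVec_homVec g x
  simp only [zeroLocus, Set.mem_ofPred_eq, pullbackGram, ← sesq_mulVec, h, sesq_smul]
  simp [hc]

lemma pullbackGram_pullbackGram (σ : K →+* K) (g h : Matrix.GeneralLinearGroup (Fin 2) K)
    (M : Matrix (Fin 2) (Fin 2) K) :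
    pullbackGram σ h (pullbackGram σ g M) = pullbackGram σ (g * h) M := by
  simp [pullbackGram, Matrix.transpose_mul, Matrix.map_mul, Matrix.mul_assoc]

lemma pullbackGram_ne_zero {σ : K →+* K} {M : Matrix (Fin 2) (Fin 2) K} (hM : M ≠ 0)
    (g : Matrix.GeneralLinearGroup (Fin 2) K) : pullbackGram σ g M ≠ 0 := by
  intro h
  apply hM
  have := pullbackGram_pullbackGram σ g g⁻¹ M
  rw [h, mul_inv_cancel] at this
  simpa [pullbackGram, Matrix.map_one] using this.symm

open Classical in
lemma zeroLocus_eq_image (σ : K →+* K) (M : Matrix (Fin 2) (Fin 2) K)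
    (g : Matrix.GeneralLinearGroup (Fin 2) K) :
    zeroLocus σ M = (fun x => g • x) '' zeroLocus σ (pullbackGram σ g M) := by
  ext x
  constructor
  · intro hx
    refine ⟨g⁻¹ • x, ?_, by simp⟩
    rw [← smul_mem_zeroLocus]
    simpa using hx
  · rintro ⟨y, hy, rfl⟩
    exact smul_mem_zeroLocus.2 hy

open Classical in
/-- `PGL(2, K)` is transitive on triples of distinct points: any three distinct points are the
images of `∞`, `0` and `1`. -/
lemma exists_smul_infty_zero_one {x y z : OnePoint K} (hxy : x ≠ y) (hxz : x ≠ z) (hyz : y ≠ z) :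
    ∃ g : Matrix.GeneralLinearGroup (Fin 2) K,
      g • OnePoint.infty = x ∧ g • ((0 : K) : OnePoint K) = y ∧ g • ((1 : K) : OnePoint K) = z := by
  set u := homVec x
  set v := homVec y
  set w := homVec z
  have det_ne : ∀ {x y : OnePoint K}, x ≠ y →
      homVec x 0 * homVec y 1 - homVec y 0 * homVec x 1 ≠ 0 := by
    intro x y h
    induction x using OnePoint.rec <;> induction y using OnePoint.rec <;>
      simp_all [sub_eq_zero, eq_comm]
  have d := det_ne hxy
  have d1 := det_ne hxz
  have d2 := det_ne hyz
  -- Cramer's rule: `w` is a multiple of the sum of the columns `α u` and `β v`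
  set α := w 0 * v 1 - v 0 * w 1
  set β := u 0 * w 1 - w 0 * u 1
  have hα : α ≠ 0 := fun h => d2 (by simp only [α] at h; linear_combination -h)
  have hβ : β ≠ 0 := d1
  let m : Matrix (Fin 2) (Fin 2) K := !![α * u 0, β * v 0; α * u 1, β * v 1]
  have hm : m.det ≠ 0 := by
    rw [Matrix.det_fin_two_of]
    have : α * u 0 * (β * v 1) - β * v 0 * (α * u 1) = α * β * (u 0 * v 1 - v 0 * u 1) := by ring
    rw [this]
    exact mul_ne_zero (mul_ne_zero hα hβ) d
  let g := Matrix.GeneralLinearGroup.mkOfDetNeZero m hm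
  have hg : g.1 = m := rfl
  have main : ∀ (a b : OnePoint K) (k : K), k ≠ 0 → m.mulVec (homVec a) = k • homVec b →
      g • a = b := by
    intro a b k hk h
    obtain ⟨c, hc, h'⟩ := exists_mulVec_homVec g a
    rw [hg, h] at h'
    refine (homVec_eq_of_smul (c := k⁻¹ * c) ?_).symm
    rw [mul_smul, ← h', smul_smul, inv_mul_cancel₀ hk, one_smul]
  refine ⟨g, main _ _ α hα ?_, main _ _ β hβ ?_, main _ _ _ d ?_⟩
  · ext i; fin_cases i <;> simp [m, u]
  · ext i; fin_cases i <;> simp [m, v]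
  · ext i
    fin_cases i <;> simp [m, α, β, u, v, w] <;> ring

end Sesquilinear

/-! ### Sublines as zero loci -/

section Sublines

variable {F K : Type*} [Field F] [Field K] [Algebra F K] {σ : K →+* K}

lemma zeroLocus_eq_range (hfix : ∀ t, σ t = t ↔ t ∈ Set.range (algebraMap F K))
    {M : Matrix (Fin 2) (Fin 2) K} (hM : M ≠ 0)
    (h00 : M 0 0 = 0) (h11 : M 1 1 = 0) (hadd : M 0 1 + M 1 0 = 0) :
    zeroLocus σ M = Set.range (OnePoint.map (algebraMap F K)) := by
  have h10 : M 1 0 = -M 0 1 := by linear_combination hadd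
  have h01 : M 0 1 ≠ 0 := by
    intro h
    apply hM
    ext i j
    fin_cases i <;> fin_cases j <;> simp [h00, h11, h10, h]
  ext x
  induction x using OnePoint.rec with
  | infty =>
    rw [infty_mem_zeroLocus]
    exact iff_of_true h00 ⟨OnePoint.infty, rfl⟩
  | coe t =>
    have : M 0 1 * t + -M 0 1 * σ t = -M 0 1 * (σ t - t) := by ring
    rw [coe_mem_zeroLocus, h00, h11, h10, zero_mul, zero_add, add_zero, this, mul_eq_zero, neg_eq_zero,
      or_iff_right h01, sub_eq_zero, hfix]
    constructor
    · rintro ⟨s, rfl⟩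
      exact ⟨(s : OnePoint F), rfl⟩
    · rintro ⟨s, hs⟩
      induction s using OnePoint.rec with
      | infty => simp at hs
      | coe s => exact ⟨s, by simpa using hs⟩

/-- A non-zero sesquilinear form with three isotropic points can be moved to a multiple of
`x σ(y) - σ(x) y`, so its isotropic points form a subline. -/
lemma zeroLocus_mem_sublines (hfix : ∀ t, σ t = t ↔ t ∈ Set.range (algebraMap F K))
    {M : Matrix (Fin 2) (Fin 2) K} (hM : M ≠ 0) {x y z : OnePoint K}
    (hx : x ∈ zeroLocus σ M) (hy : y ∈ zeroLocus σ M) (hz : z ∈ zeroLocus σ M)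
    (hxy : x ≠ y) (hxz : x ≠ z) (hyz : y ≠ z) : zeroLocus σ M ∈ sublines F K := by
  classical
  obtain ⟨g, rfl, rfl, rfl⟩ := exists_smul_infty_zero_one hxy hxz hyz
  simp only [smul_mem_zeroLocus] at hx hy hz
  refine ⟨g, ?_⟩
  have h00 := infty_mem_zeroLocus.1 hx
  have h11 : pullbackGram σ g M 1 1 = 0 := by simpa using coe_mem_zeroLocus.1 hy
  rw [zeroLocus_eq_image σ M g, zeroLocus_eq_range hfix (pullbackGram_ne_zero hM g) h00 h11]
  simpa [h00, h11] using coe_mem_zeroLocus.1 hz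

lemma ncard_zeroLocus_le_two_or_mem_sublines [Finite K]
    (hfix : ∀ t, σ t = t ↔ t ∈ Set.range (algebraMap F K))
    {M : Matrix (Fin 2) (Fin 2) K} (hM : M ≠ 0) :
    (zeroLocus σ M).ncard ≤ 2 ∨ zeroLocus σ M ∈ sublines F K := by
  have : Finite (OnePoint K) := inferInstanceAs (Finite (Option K))
  by_contra! h
  obtain ⟨x, y, z, hx, hy, hz, hxy, hxz, hyz⟩ := (Set.two_lt_ncard_iff (Set.toFinite _)).1 h.1
  exact h.2 (zeroLocus_mem_sublines hfix hM hx hy hz hxy hxz hyz)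

lemma ncard_of_mem_sublines [Finite F] {B : Set (OnePoint K)} (hB : B ∈ sublines F K) :
    B.ncard = Nat.card F + 1 := by
  classical
  obtain ⟨g, rfl⟩ := hB
  have hinj : Function.Injective (OnePoint.map (algebraMap F K)) :=
    Option.map_injective (algebraMap F K).injective
  rw [Set.ncard_image_of_injective _ (MulAction.injective g), ← Set.image_univ,
    Set.ncard_image_of_injective _ hinj, Set.ncard_univ]
  exact Finite.card_option

lemma ne_univ_of_mem_sublines [Finite K] (hs : ¬ Function.Surjective (algebraMap F K))
    {B : Set (OnePoint K)} (hB : B ∈ sublines F K) : B ≠ Set.univ := by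
  have : Finite F := Finite.of_injective _ (algebraMap F K).injective
  rintro rfl
  have h := ncard_of_mem_sublines hB
  rw [Set.ncard_univ] at h
  have h1 : Nat.card (OnePoint K) = Nat.card K + 1 := Finite.card_option
  exact hs ((algebraMap F K).injective.bijective_of_nat_card_le (by omega)).2

open Classical in
lemma zeroLocus_pullbackGram_inv (hfix : ∀ t, σ t = t ↔ t ∈ Set.range (algebraMap F K)) {c : K}
    (hc : c ≠ 0) (g : Matrix.GeneralLinearGroup (Fin 2) K) :
    pullbackGram σ g⁻¹ !![0, c; -c, 0] ≠ 0 ∧ zeroLocus σ (pullbackGram σ g⁻¹ !![0, c; -c, 0]) =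
      (fun x => g • x) '' Set.range (OnePoint.map (algebraMap F K)) := by
  have hJ : !![0, c; -c, 0] ≠ 0 := fun h => hc (by simpa using congrFun (congrFun h 0) 1)
  refine ⟨pullbackGram_ne_zero hJ _, ?_⟩
  rw [zeroLocus_eq_image σ _ g, pullbackGram_pullbackGram, inv_mul_cancel]
  have : pullbackGram σ 1 !![0, c; -c, 0] = !![0, c; -c, 0] := by
    simp [pullbackGram, Matrix.map_one]
  rw [this, zeroLocus_eq_range hfix hJ (by simp) (by simp) (by simp)]

lemma exists_zeroLocus_eq_of_mem_sublines
    (hfix : ∀ t, σ t = t ↔ t ∈ Set.range (algebraMap F K)) {B : Set (OnePoint K)}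
    (hB : B ∈ sublines F K) : ∃ M : Matrix (Fin 2) (Fin 2) K, M ≠ 0 ∧ zeroLocus σ M = B := by
  obtain ⟨g, rfl⟩ := hB
  exact ⟨_, zeroLocus_pullbackGram_inv hfix one_ne_zero g⟩

/-- Every subline is the isotropic locus of a Hermitian form: it is equivalent to the isotropic
locus of `ζ (x σ(y) - σ(x) y)`, where `σ ζ = -ζ`. -/
lemma exists_hermitian_of_mem_sublines (hσ : ∀ t, σ (σ t) = t)
    (hfix : ∀ t, σ t = t ↔ t ∈ Set.range (algebraMap F K)) {ζ : K} (hζ₀ : ζ ≠ 0) (hζ : σ ζ = -ζ)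
    {B : Set (OnePoint K)} (hB : B ∈ sublines F K) :
    ∃ M : Matrix (Fin 2) (Fin 2) K, M ≠ 0 ∧ (∀ i j, σ (M i j) = M j i) ∧ zeroLocus σ M = B := by
  obtain ⟨g, rfl⟩ := hB
  obtain ⟨hM, hB⟩ := zeroLocus_pullbackGram_inv hfix hζ₀ g
  refine ⟨_, hM, fun i j => ?_, hB⟩
  simp only [pullbackGram, Matrix.mul_apply, Matrix.transpose_apply, Matrix.map_apply,
    Fin.sum_univ_two, map_add, map_mul, hσ, Matrix.of_apply, Matrix.cons_val', Matrix.cons_val_zero,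
    Matrix.cons_val_one, Matrix.cons_val_fin_one, map_neg, map_zero, hζ]
  ring

end Sublines

/-! ### Codes whose zero sets are sublines -/

section SublineCodes

variable {F K k ι : Type*} [Field F] [Field K] [Algebra F K] [Field k]

lemma wordWeight_add_ncard_zeros [Finite ι] (c : ι → k) :
    wordWeight c + {i | c i = 0}.ncard = Nat.card ι := by
  have : {i | c i = 0} = (Function.support c)ᶜ := by ext; simp
  rw [wordWeight, this, Set.ncard_add_ncard_compl]

/-- The zero sets of the words of the code `C` on the points of `PG(1, K)`, transported by the
bijection `e`, are either small or sublines, and all sublines occur. -/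
structure HasSublineZeros (F : Type*) {K k ι : Type*} [Field F] [Field K] [Algebra F K] [Field k]
    (e : ι ≃ OnePoint K) (C : Submodule k (ι → k)) : Prop where
  ncard_le_or : ∀ c ∈ C, c ≠ 0 → {i | c i = 0}.ncard ≤ 2 ∨ e '' {i | c i = 0} ∈ sublines F K
  exists_word : ∀ B ∈ sublines F K, ∃ c ∈ C, c ≠ 0 ∧ e '' {i | c i = 0} = B

lemma sublines_nonempty : (sublines F K).Nonempty := by
  classical
  exact ⟨_, 1, rfl⟩

namespace HasSublineZeros

variable [Finite F] [Finite K] {e : ι ≃ OnePoint K} {C : Submodule k (ι → k)}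

lemma wordWeight_eq (e : ι ≃ OnePoint K) {c : ι → k} (hc : e '' {i | c i = 0} ∈ sublines F K) :
    wordWeight c = Nat.card K - Nat.card F := by
  have : Finite (OnePoint K) := inferInstanceAs (Finite (Option K))
  have : Finite ι := Finite.of_equiv _ e.symm
  have h := wordWeight_add_ncard_zeros c
  have h1 := ncard_of_mem_sublines hc
  rw [Set.ncard_image_of_injective _ e.injective] at h1
  have h2 : Nat.card ι = Nat.card K + 1 := (Nat.card_congr e).trans Finite.card_option
  omega

lemma le_wordWeight (h : HasSublineZeros F e C) (hq : 2 ≤ Nat.card F) {c : ι → k} (hc : c ∈ C)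
    (hc₀ : c ≠ 0) : Nat.card K - Nat.card F ≤ wordWeight c ∧
      (wordWeight c = Nat.card K - Nat.card F → e '' {i | c i = 0} ∈ sublines F K) := by
  have : Finite (OnePoint K) := inferInstanceAs (Finite (Option K))
  have : Finite ι := Finite.of_equiv _ e.symm
  rcases h.ncard_le_or c hc hc₀ with h1 | h1
  · have h0 := wordWeight_add_ncard_zeros c
    have h2 : Nat.card ι = Nat.card K + 1 := (Nat.card_congr e).trans Finite.card_option
    have h3 : Nat.card F ≤ Nat.card K := Nat.card_le_card_of_injective _ (algebraMap F K).injective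
    refine ⟨by omega, fun h4 => by omega⟩
  · exact ⟨(wordWeight_eq e h1).ge, fun _ => h1⟩

theorem minDistance_eq (h : HasSublineZeros F e C) (hq : 2 ≤ Nat.card F) :
    minDistance C = Nat.card K - Nat.card F := by
  obtain ⟨B, hB⟩ := sublines_nonempty (F := F) (K := K)
  obtain ⟨c, hc, hc₀, rfl⟩ := h.exists_word B hB
  refine le_antisymm (Nat.sInf_le ⟨c, hc, hc₀, wordWeight_eq e hB⟩) ?_
  refine le_csInf ⟨_, c, hc, hc₀, rfl⟩ ?_
  rintro w ⟨d, hd, hd₀, rfl⟩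
  exact (h.le_wordWeight hq hd hd₀).1

lemma mem_minWords_iff (h : HasSublineZeros F e C) (hq : 2 ≤ Nat.card F) {c : ι → k} :
    c ∈ minWords C ↔ c ∈ C ∧ c ≠ 0 ∧ e '' {i | c i = 0} ∈ sublines F K := by
  rw [minWords, h.minDistance_eq hq]
  constructor
  · rintro ⟨h1, h2, h3⟩
    exact ⟨h1, h2, (h.le_wordWeight hq h1 h2).2 h3⟩
  · rintro ⟨h1, h2, h3⟩
    exact ⟨h1, h2, wordWeight_eq e h3⟩

theorem mem_minZeroSets_iff (h : HasSublineZeros F e C) (hq : 2 ≤ Nat.card F) {Z : Set ι} :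
    Z ∈ minZeroSets C ↔ e '' Z ∈ sublines F K := by
  constructor
  · rintro ⟨c, hc, rfl⟩
    exact ((h.mem_minWords_iff hq).1 hc).2.2
  · intro hZ
    obtain ⟨c, hc, hc₀, hcZ⟩ := h.exists_word _ hZ
    refine ⟨c, (h.mem_minWords_iff hq).2 ⟨hc, hc₀, hcZ ▸ hZ⟩, ?_⟩
    exact (e.injective.image_injective hcZ).symm

theorem mem_minSupports_iff (h : HasSublineZeros F e C) (hq : 2 ≤ Nat.card F) {S : Set ι} :
    S ∈ minSupports C ↔ e '' Sᶜ ∈ sublines F K := by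
  rw [← h.mem_minZeroSets_iff hq]
  refine exists_congr fun c => and_congr_right fun _ => ?_
  have : {i | c i = 0} = (Function.support c)ᶜ := by ext; simp
  rw [this, compl_inj_iff]

/-- The minimum-support design is isomorphic to the complement of the Miquelian plane. -/
theorem isIso_miquelianPlane (h : HasSublineZeros F e C) (hq : 2 ≤ Nat.card F) :
    IncidenceStructure.IsIso e (minSupportDesign C) (miquelianPlane F K).complement := by
  ext T
  constructor
  · rintro ⟨S, hS, rfl⟩
    refine ⟨_, (h.mem_minSupports_iff hq).1 hS, ?_⟩
    rw [Set.image_compl_eq e.bijective, compl_compl]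
  · rintro ⟨B, hB, rfl⟩
    refine ⟨e ⁻¹' Bᶜ, (h.mem_minSupports_iff hq).2 ?_, (Set.image_preimage_eq _ e.surjective).symm⟩
    rwa [Set.preimage_compl, compl_compl, Set.image_preimage_eq _ e.surjective]

end HasSublineZeros

end SublineCodes

/-! ### The elliptic quadric -/

section Quadric

variable {F K : Type*} [Field F]

/-- `σ` is the conjugation of the quadratic extension `K = F(ζ)` with `ζ² = μ`, in characteristic
other than two, and `re`, `im` are the coordinates with respect to the basis `1, ζ`. -/
structure QuadraticCoords [Field K] [Algebra F K] (σ : K →+* K) (ζ : K) (μ : F) (re im : K → F) : Prop where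
  two_ne_zero : (2 : F) ≠ 0
  fixes : ∀ x : F, σ (algebraMap F K x) = algebraMap F K x
  ne_zero : ζ ≠ 0
  conj_eq : σ ζ = -ζ
  sq_eq : algebraMap F K μ = ζ ^ 2
  decomp : ∀ t, t = algebraMap F K (re t) + algebraMap F K (im t) * ζ

/-- Coordinates of the point `ι t` of the quadric: `(1, x, y, x² - μ y²)` for `t = x + y ζ`, and
`(0, 0, 0, 1)` for `t = ∞`. -/
def quadricVec (μ : F) (re im : K → F) (t : OnePoint K) : Fin 4 → F :=
  t.elim ![0, 0, 0, 1] fun t => ![1, re t, im t, re t ^ 2 - μ * im t ^ 2]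

/-- The Hermitian Gram matrix attached to the polar hyperplane of `p` with respect to
`X₀X₃ - (X₁² - μ X₂²)`. -/
def hermGram [Field K] [Algebra F K] (ζ : K) (p : Fin 4 → F) : Matrix (Fin 2) (Fin 2) K :=
  !![algebraMap F K (p 0), -algebraMap F K (p 1) + algebraMap F K (p 2) * ζ;
    -algebraMap F K (p 1) - algebraMap F K (p 2) * ζ, algebraMap F K (p 3)]

lemma ellipticForm_apply (μ : F) (v : Fin 4 → F) :
    ellipticForm μ v = v 0 * v 3 - (v 1 ^ 2 - μ * v 2 ^ 2) := by
  simp [ellipticForm, pow_two]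

lemma polar_ellipticForm (μ : F) (v w : Fin 4 → F) :
    QuadraticMap.polar (ellipticForm μ) v w =
      v 0 * w 3 + v 3 * w 0 - 2 * v 1 * w 1 + 2 * μ * v 2 * w 2 := by
  simp only [QuadraticMap.polar, ellipticForm_apply, Pi.add_apply]
  ring

lemma quadricVec_infty (μ : F) (re im : K → F) :
    quadricVec μ re im OnePoint.infty = ![0, 0, 0, 1] := rfl

lemma quadricVec_coe (μ : F) (re im : K → F) (t : K) :
    quadricVec μ re im t = ![1, re t, im t, re t ^ 2 - μ * im t ^ 2] := rfl

lemma quadricVec_ne_zero (μ : F) (re im : K → F) (t : OnePoint K) : quadricVec μ re im t ≠ 0 := by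
  induction t using OnePoint.rec with
  | infty => intro h; simpa [quadricVec_infty] using congrFun h 3
  | coe t => intro h; simpa [quadricVec_coe] using congrFun h 0

lemma ellipticForm_quadricVec (μ : F) (re im : K → F) (t : OnePoint K) :
    ellipticForm μ (quadricVec μ re im t) = 0 := by
  induction t using OnePoint.rec <;> simp [ellipticForm_apply, quadricVec_infty, quadricVec_coe]

/-- The polarity of the quadric is non-degenerate: every linear functional is the polar form with
some vector. -/
lemma exists_polar_eq {μ : F} (h2 : (2 : F) ≠ 0) (hμ : μ ≠ 0) (a : Fin 4 → F) :
    ∃ p : Fin 4 → F, (p = 0 → a = 0) ∧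
      ∀ v, ∑ i, a i * v i = QuadraticMap.polar (ellipticForm μ) p v := by
  refine ⟨![a 3, -a 1 / 2, a 2 / (2 * μ), a 0], fun h => ?_, fun v => ?_⟩
  · have h0 := congrFun h 0
    have h1 := congrFun h 1
    have h3 := congrFun h 2
    have h4 := congrFun h 3
    simp [h2, hμ] at h0 h1 h3 h4
    ext i
    fin_cases i <;> simpa
  · simp only [polar_ellipticForm, Fin.sum_univ_four, Matrix.cons_val]
    field_simp
    ring

lemma polar_ne_zero {μ : F} (h2 : (2 : F) ≠ 0) (hμ : μ ≠ 0) {p : Fin 4 → F}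
    (h : ∀ v, QuadraticMap.polar (ellipticForm μ) p v = 0) : p = 0 := by
  simp only [polar_ellipticForm] at h
  have e0 := h ![0, 0, 0, 1]
  have e1 := h ![0, 1, 0, 0]
  have e2 := h ![0, 0, 1, 0]
  have e3 := h ![1, 0, 0, 0]
  simp [h2, hμ] at e0 e1 e2 e3
  ext i
  fin_cases i <;> simpa

lemma mem_quadric_iff {Φ : QuadraticForm F (Fin 4 → F)} {v : Fin 4 → F} (hv : v ≠ 0) :
    Projectivization.mk F v hv ∈ quadric Φ ↔ Φ v = 0 := by
  obtain ⟨a, ha⟩ := Projectivization.exists_smul_eq_mk_rep F v hv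
  change Φ (Projectivization.mk F v hv).rep = 0 ↔ _
  rw [← ha, Units.smul_def, QuadraticMap.map_smul]
  simp

/-- The map `ι` from the projective line to the quadric. -/
def quadricPoint (μ : F) (re im : K → F) (t : OnePoint K) : quadric (ellipticForm μ) :=
  ⟨.mk F (quadricVec μ re im t) (quadricVec_ne_zero μ re im t),
    (mem_quadric_iff _).2 (ellipticForm_quadricVec μ re im t)⟩

lemma submodule_quadricPoint {μ : F} {re im : K → F}
    (t : OnePoint K) :
    (quadricPoint μ re im t).1.submodule = Submodule.span F {quadricVec μ re im t} := rfl

lemma quadricPoint_submodule_le_iff {μ : F} {re im : K → F}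
    (t : OnePoint K) (E : Submodule F (Fin 4 → F)) :
    (quadricPoint μ re im t).1.submodule ≤ E ↔ quadricVec μ re im t ∈ E := by
  rw [submodule_quadricPoint, Submodule.span_singleton_le_iff_mem]

lemma exists_plane_eq_polar {μ : F} (h2 : (2 : F) ≠ 0) (hμ : μ ≠ 0)
    (E : Submodule F (Fin 4 → F)) (hE : Module.finrank F E = 3) :
    ∃ p : Fin 4 → F, p ≠ 0 ∧ ∀ v, v ∈ E ↔ QuadraticMap.polar (ellipticForm μ) p v = 0 := by
  have hlt : E < ⊤ := by
    refine lt_top_iff_ne_top.2 fun h => ?_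
    rw [h, finrank_top, Module.finrank_fin_fun] at hE
    omega
  obtain ⟨f, hf, hle⟩ := Submodule.exists_le_ker_of_lt_top E hlt
  have hker := Module.Dual.finrank_ker_add_one_of_ne_zero hf
  rw [Module.finrank_fin_fun] at hker
  have heq := Submodule.eq_of_le_of_finrank_eq hle (by omega)
  obtain ⟨p, -, hp⟩ := exists_polar_eq h2 hμ fun i => f (Pi.single i 1)
  have hfp : ∀ v, f v = QuadraticMap.polar (ellipticForm μ) p v := by
    intro v
    rw [← hp, LinearMap.pi_apply_eq_sum_univ f v]
    refine Finset.sum_congr rfl fun i _ => ?_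
    rw [smul_eq_mul, mul_comm]
    congr 2
    ext j
    simp [Pi.single_apply, eq_comm]
  refine ⟨p, ?_, fun v => ?_⟩
  · rintro rfl
    apply hf
    ext v
    simp [hfp]
  · rw [heq, LinearMap.mem_ker, hfp]

lemma exists_plane_of_polar {μ : F} (h2 : (2 : F) ≠ 0) (hμ : μ ≠ 0) {p : Fin 4 → F} (hp : p ≠ 0) :
    ∃ E : Submodule F (Fin 4 → F), Module.finrank F E = 3 ∧
      ∀ v, v ∈ E ↔ QuadraticMap.polar (ellipticForm μ) p v = 0 := by
  let f : Module.Dual F (Fin 4 → F) := (ellipticForm μ).polarBilin p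
  have hf : f ≠ 0 := fun h => hp <| polar_ne_zero h2 hμ fun v => LinearMap.congr_fun h v
  have hker := Module.Dual.finrank_ker_add_one_of_ne_zero hf
  rw [Module.finrank_fin_fun] at hker
  exact ⟨LinearMap.ker f, by omega, fun v => Iff.rfl⟩

/-- The polar hyperplane of `p` is tangent exactly if `p` is on the quadric. -/
lemma isTangentPlane_iff {μ : F} (h2 : (2 : F) ≠ 0) (hμ : μ ≠ 0) {p : Fin 4 → F} (hp : p ≠ 0)
    {E : Submodule F (Fin 4 → F)}
    (hE : ∀ v, v ∈ E ↔ QuadraticMap.polar (ellipticForm μ) p v = 0) :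
    IsTangentPlane (ellipticForm μ) E ↔ ellipticForm μ p = 0 := by
  constructor
  · rintro ⟨P, hP, h⟩
    have hker : LinearMap.ker ((ellipticForm μ).polarBilin P.rep) ≤
        LinearMap.ker ((ellipticForm μ).polarBilin p) := fun v hv => (hE v).1 ((h v).2 hv)
    obtain ⟨c, hc⟩ : ∃ c : F, c • (ellipticForm μ).polarBilin P.rep =
        (ellipticForm μ).polarBilin p := by
      have := mem_span_of_iInf_ker_le_ker (ι := Unit) (L := fun _ => (ellipticForm μ).polarBilin P.rep)
        (by simpa using hker)
      rwa [Set.range_const, Submodule.mem_span_singleton] at this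
    have : p = c • P.rep := by
      rw [← sub_eq_zero]
      refine polar_ne_zero h2 hμ fun v => ?_
      have := LinearMap.congr_fun hc v
      simp only [LinearMap.smul_apply, QuadraticMap.polarBilin_apply_apply] at this
      rw [QuadraticMap.polar_sub_left, QuadraticMap.polar_smul_left, ← this]
      simp
    rw [this, QuadraticMap.map_smul, show ellipticForm μ P.rep = 0 from hP, smul_zero]
  · intro h
    obtain ⟨a, ha⟩ := Projectivization.exists_smul_eq_mk_rep F p hp
    refine ⟨.mk F p hp, (mem_quadric_iff hp).2 h, fun v => ?_⟩
    rw [hE, ← ha, Units.smul_def, QuadraticMap.polar_smul_left]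
    simp

namespace QuadraticCoords

variable [Field K] [Algebra F K] {σ : K →+* K} {ζ : K} {μ : F} {re im : K → F}

lemma two_ne_zero' (h : QuadraticCoords σ ζ μ re im) : (2 : K) ≠ 0 := by
  rw [← map_ofNat (algebraMap F K) 2]
  exact (_root_.map_ne_zero (algebraMap F K)).2 h.two_ne_zero

lemma mu_ne_zero (h : QuadraticCoords σ ζ μ re im) : μ ≠ 0 := by
  rintro rfl
  exact h.ne_zero (by simpa using h.sq_eq.symm)

lemma eq_zero_of_add_eq_zero (h : QuadraticCoords σ ζ μ re im) {x y : F}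
    (hxy : algebraMap F K x + algebraMap F K y * ζ = 0) : x = 0 ∧ y = 0 := by
  have h1 := congrArg σ hxy
  simp only [map_add, map_mul, h.fixes, h.conj_eq, map_zero] at h1
  have h3 : 2 * algebraMap F K x = 0 := by linear_combination hxy + h1
  have h4 : 2 * ζ * algebraMap F K y = 0 := by linear_combination hxy - h1
  simpa [h.two_ne_zero', h.ne_zero] using And.intro h3 h4

lemma coords_unique (h : QuadraticCoords σ ζ μ re im) {x y x' y' : F}
    (hxy : algebraMap F K x + algebraMap F K y * ζ = algebraMap F K x' + algebraMap F K y' * ζ) :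
    x = x' ∧ y = y' := by
  have := h.eq_zero_of_add_eq_zero (x := x - x') (y := y - y') (by
    rw [map_sub, map_sub]; linear_combination hxy)
  simpa [sub_eq_zero] using this

lemma re_im_eq (h : QuadraticCoords σ ζ μ re im) (x y : F) :
    re (algebraMap F K x + algebraMap F K y * ζ) = x ∧
      im (algebraMap F K x + algebraMap F K y * ζ) = y :=
  h.coords_unique (h.decomp _).symm

lemma mul_conj (h : QuadraticCoords σ ζ μ re im) (x y : F) :
    (algebraMap F K x + algebraMap F K y * ζ) * σ (algebraMap F K x + algebraMap F K y * ζ) =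
      algebraMap F K (x ^ 2 - μ * y ^ 2) := by
  simp only [map_add, map_mul, map_sub, map_pow, h.fixes, h.conj_eq, h.sq_eq]
  ring

/-- The norm form of `K` over `F` is anisotropic. -/
lemma eq_zero_of_norm_eq_zero (h : QuadraticCoords σ ζ μ re im) {x y : F}
    (hxy : x ^ 2 - μ * y ^ 2 = 0) : x = 0 ∧ y = 0 := by
  have := h.mul_conj x y
  rw [hxy, map_zero, mul_eq_zero, map_eq_zero, or_self] at this
  exact h.eq_zero_of_add_eq_zero this

lemma conj_conj (h : QuadraticCoords σ ζ μ re im) (t : K) : σ (σ t) = t := by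
  rw [h.decomp t]
  simp [h.fixes, h.conj_eq]

lemma exists_algebraMap_of_conj_eq (h : QuadraticCoords σ ζ μ re im) {t : K} (ht : σ t = t) :
    ∃ x : F, algebraMap F K x = t := by
  refine ⟨re t, ?_⟩
  have h1 := ht
  rw [h.decomp t] at h1
  simp only [map_add, map_mul, h.fixes, h.conj_eq] at h1
  have h2 : 2 * ζ * algebraMap F K (im t) = 0 := by linear_combination -h1
  have h3 : algebraMap F K (im t) = 0 := by simpa [h.two_ne_zero', h.ne_zero] using h2
  conv_rhs => rw [h.decomp t, h3]
  ring

lemma conj_eq_iff (h : QuadraticCoords σ ζ μ re im) (t : K) :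
    σ t = t ↔ t ∈ Set.range (algebraMap F K) := by
  refine ⟨h.exists_algebraMap_of_conj_eq, ?_⟩
  rintro ⟨x, rfl⟩
  exact h.fixes x

lemma not_surjective (h : QuadraticCoords σ ζ μ re im) :
    ¬ Function.Surjective (algebraMap F K) := by
  intro hs
  obtain ⟨z, hz⟩ := hs ζ
  have h1 := h.fixes z
  rw [hz, h.conj_eq] at h1
  have h3 : 2 * ζ = 0 := by linear_combination -h1
  exact h.ne_zero (by simpa [h.two_ne_zero'] using h3)

/-- A point of the quadric is in the polar hyperplane of `p` exactly if the corresponding point of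
the projective line is isotropic for the Hermitian form of `p`. -/
lemma mem_zeroLocus_hermGram (h : QuadraticCoords σ ζ μ re im) (p : Fin 4 → F) (x : OnePoint K) :
    x ∈ zeroLocus σ (hermGram ζ p) ↔
      QuadraticMap.polar (ellipticForm μ) p (quadricVec μ re im x) = 0 := by
  induction x using OnePoint.rec with
  | infty => simp [infty_mem_zeroLocus, hermGram, polar_ellipticForm, quadricVec_infty]
  | coe t =>
    rw [coe_mem_zeroLocus, ← map_eq_zero (algebraMap F K)]
    refine Eq.congr_left ?_
    rw [quadricVec_coe, polar_ellipticForm]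
    have hs : σ t = algebraMap F K (re t) - algebraMap F K (im t) * ζ := by
      conv_lhs => rw [h.decomp t]
      simp only [map_add, map_mul, h.fixes, h.conj_eq]
      ring
    have ht := h.decomp t
    generalize re t = x at *
    generalize im t = y at *
    rw [hs]
    subst ht
    simp only [hermGram, Matrix.of_apply, Matrix.cons_val, map_add, map_sub, map_mul,
      map_pow, h.sq_eq, map_ofNat, map_one]
    ring

lemma hermGram_ne_zero (h : QuadraticCoords σ ζ μ re im) {p : Fin 4 → F} (hp : p ≠ 0) :
    hermGram ζ p ≠ 0 := by
  intro h0
  apply hp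
  have e0 := congrFun (congrFun h0 0) 0
  have e1 := congrFun (congrFun h0 0) 1
  have e3 := congrFun (congrFun h0 1) 1
  simp only [hermGram, Matrix.of_apply, Matrix.cons_val, Matrix.zero_apply, map_eq_zero] at e0 e1 e3
  obtain ⟨e1, e2⟩ := h.eq_zero_of_add_eq_zero (x := -p 1) (y := p 2) (by simpa using e1)
  ext i
  fin_cases i <;> simp_all

lemma exists_hermGram_eq (h : QuadraticCoords σ ζ μ re im) {M : Matrix (Fin 2) (Fin 2) K}
    (hM : ∀ i j, σ (M i j) = M j i) : ∃ p : Fin 4 → F, hermGram ζ p = M := by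
  obtain ⟨a, ha⟩ := h.exists_algebraMap_of_conj_eq (hM 0 0)
  obtain ⟨d, hd⟩ := h.exists_algebraMap_of_conj_eq (hM 1 1)
  have hb := h.decomp (M 0 1)
  have hc := hM 0 1
  rw [hb] at hc
  simp only [map_add, map_mul, h.fixes, h.conj_eq] at hc
  refine ⟨![a, -re (M 0 1), im (M 0 1), d], ?_⟩
  ext i j
  fin_cases i <;> fin_cases j
  · simpa [hermGram] using ha
  · simpa [hermGram] using hb.symm
  · simpa [hermGram, sub_eq_add_neg] using hc
  · simpa [hermGram] using hd

/-- If `p` is off the quadric, then its Hermitian form has three isotropic points.  If the leading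
coefficient is `0`, they are `∞` and two points on an affine line; otherwise the isotropic points
form a circle `t ↦ N (t - a) = c` with `c ≠ 0`, and multiplication of `t - a` by the elements `1`,
`-1` and `(1 - ζ) / (1 + ζ)` of norm one gives three points on it. -/
lemma exists_three_zeros (h : QuadraticCoords σ ζ μ re im)
    (hnorm : ∀ c : F, ∃ s : K, s * σ s = algebraMap F K c) {p : Fin 4 → F}
    (hp : ellipticForm μ p ≠ 0) :
    ∃ x y z : OnePoint K, x ∈ zeroLocus σ (hermGram ζ p) ∧ y ∈ zeroLocus σ (hermGram ζ p) ∧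
      z ∈ zeroLocus σ (hermGram ζ p) ∧ x ≠ y ∧ x ≠ z ∧ y ≠ z := by
  have h2 := h.two_ne_zero'
  have hζ := h.ne_zero
  set A := algebraMap F K (p 0) with hA
  set D := algebraMap F K (p 3) with hD
  set B := -algebraMap F K (p 1) + algebraMap F K (p 2) * ζ with hB
  set B' := -algebraMap F K (p 1) - algebraMap F K (p 2) * ζ with hB'
  have hBB : σ B = B' := by
    simp only [hB, hB', map_add, map_mul, map_neg, h.fixes, h.conj_eq]
    ring
  have hBB' : σ B' = B := by rw [← hBB, h.conj_conj]
  have hAσ : σ A = A := h.fixes _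
  have hDσ : σ D = D := h.fixes _
  have hmem : ∀ t : K, (t : OnePoint K) ∈ zeroLocus σ (hermGram ζ p) ↔
      A * (t * σ t) + B * t + B' * σ t + D = 0 := fun t => coe_mem_zeroLocus
  have hΦ : algebraMap F K (ellipticForm μ p) = A * D - B * B' := by
    rw [ellipticForm_apply]
    simp only [map_sub, map_mul, map_pow, h.sq_eq]
    ring
  have hΦ₀ : A * D - B * B' ≠ 0 := by
    rw [← hΦ]
    exact (_root_.map_ne_zero _).2 hp
  by_cases hA0 : A = 0
  · have hB0 : B ≠ 0 := by
      intro h0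
      simp [hA0, h0] at hΦ₀
    have hB0' : B' ≠ 0 := by
      intro h0
      simp [hA0, h0] at hΦ₀
    refine ⟨OnePoint.infty, ((-D / (2 * B) : K) : OnePoint K), (((-D / 2 + ζ) / B : K) : OnePoint K),
      infty_mem_zeroLocus.2 hA0, (hmem _).2 ?_, (hmem _).2 ?_, by simp, by simp, ?_⟩
    · simp only [map_div₀, map_neg, map_mul, map_ofNat, hDσ, hBB, hA0]
      field_simp
      ring
    · simp only [map_div₀, map_add, map_neg, map_ofNat, hDσ, hBB, hA0, h.conj_eq]
      field_simp
      ring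
    · rw [Ne, OnePoint.coe_eq_coe]
      intro h0
      apply hζ
      field_simp at h0
      have h3 : 2 * ζ = 0 := by linear_combination -h0
      simpa [h2] using h3
  · obtain ⟨s, hs⟩ := hnorm (-ellipticForm μ p)
    rw [map_neg, hΦ] at hs
    have hs0 : s ≠ 0 := by
      rintro rfl
      apply hΦ₀
      rw [zero_mul] at hs
      linear_combination hs
    have hplus : ∀ ε : K, ε * ε = 1 → 1 + ε * ζ ≠ 0 := by
      intro ε hε h0
      have h1 : σ (1 + ε * ζ) = 0 := by rw [h0, map_zero]
      have hζε : ζ = -ε := by linear_combination ε * h0 - ζ * hε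
      have : ζ = -ζ := by
        rw [← h.conj_eq, hζε]
        rcases mul_self_eq_one_iff.1 hε with rfl | rfl <;> simp
      exact hζ (by
        have h3 : 2 * ζ = 0 := by linear_combination this
        simpa [h2] using h3)
    have hp1 : 1 + ζ ≠ 0 := by simpa using hplus 1 (by ring)
    have hm1 : 1 - ζ ≠ 0 := by simpa [sub_eq_add_neg] using hplus (-1) (by ring)
    -- points of the circle from elements of norm one
    have hu : ∀ u : K, u * σ u = 1 →
        (((u * s - B') / A : K) : OnePoint K) ∈ zeroLocus σ (hermGram ζ p) := by
      intro u hu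
      rw [hmem]
      simp only [map_div₀, map_sub, map_mul, hAσ, hBB']
      field_simp
      linear_combination s * σ s * hu + hs
    have hne : ∀ u w : K, u ≠ w → (((u * s - B') / A : K) : OnePoint K) ≠
        (((w * s - B') / A : K) : OnePoint K) := by
      intro u w huw
      rw [Ne, OnePoint.coe_eq_coe, div_left_inj' hA0, sub_left_inj, mul_left_inj' hs0]
      exact huw
    refine ⟨_, _, _, hu 1 (by simp), hu (-1) (by simp), hu ((1 - ζ) / (1 + ζ)) ?_, hne _ _ ?_,
      hne _ _ ?_, hne _ _ ?_⟩
    · simp only [map_div₀, map_sub, map_add, map_one, h.conj_eq]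
      have : 1 + -ζ ≠ 0 := by rwa [← sub_eq_add_neg]
      field_simp
      ring
    · intro h0
      exact h2 (by linear_combination h0)
    · intro h0
      field_simp at h0
      have h3 : 2 * ζ = 0 := by linear_combination h0
      exact hζ (by simpa [h2] using h3)
    · intro h0
      field_simp at h0
      exact h2 (by linear_combination -h0)

/-- If `p` is on the quadric, then the only isotropic point of its Hermitian form is `p` itself. -/
lemma zeroLocus_subsingleton (h : QuadraticCoords σ ζ μ re im) {p : Fin 4 → F} (hp₀ : p ≠ 0)
    (hp : ellipticForm μ p = 0) : (zeroLocus σ (hermGram ζ p)).Subsingleton := by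
  rw [ellipticForm_apply] at hp
  by_cases h0 : p 0 = 0
  · obtain ⟨h1, h2⟩ := h.eq_zero_of_norm_eq_zero (x := p 1) (y := p 2) (by
      rw [h0] at hp; linear_combination -hp)
    have h3 : p 3 ≠ 0 := by
      intro h3
      apply hp₀
      ext i
      fin_cases i <;> simpa
    suffices ∀ x ∈ zeroLocus σ (hermGram ζ p), x = OnePoint.infty from
      fun x hx y hy => (this x hx).trans (this y hy).symm
    intro x hx
    induction x using OnePoint.rec with
    | infty => rfl
    | coe t =>
      rw [coe_mem_zeroLocus] at hx
      simp [hermGram, h0, h1, h2, h3] at hx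
  · set A := algebraMap F K (p 0) with hA
    have hA0 : A ≠ 0 := (_root_.map_ne_zero _).2 h0
    set b := algebraMap F K (p 1) + algebraMap F K (p 2) * ζ with hb
    suffices ∀ x ∈ zeroLocus σ (hermGram ζ p), x = ((b / A : K) : OnePoint K) from
      fun x hx y hy => (this x hx).trans (this y hy).symm
    intro x hx
    induction x using OnePoint.rec with
    | infty =>
      rw [infty_mem_zeroLocus] at hx
      exact absurd hx hA0
    | coe t =>
      rw [coe_mem_zeroLocus] at hx
      simp only [hermGram, Matrix.of_apply, Matrix.cons_val] at hx
      have hn := h.mul_conj (p 1) (p 2)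
      have hpK := congrArg (algebraMap F K) hp
      simp only [map_sub, map_mul, map_zero, ← hA] at hpK
      simp only [map_sub, map_mul, map_add, h.fixes, h.conj_eq] at hn
      have : (A * t - b) * σ (A * t - b) = 0 := by
        simp only [hb, hA, map_sub, map_mul, map_add, h.fixes, h.conj_eq] at hx ⊢
        linear_combination (algebraMap F K (p 0)) * hx + hn - hpK
      rw [mul_eq_zero, map_eq_zero, or_self, sub_eq_zero] at this
      rw [OnePoint.coe_eq_coe, eq_div_iff hA0, mul_comm]
      exact this

/-- The plane section of the quadric by the polar plane of `p` is a subline exactly if `p` is off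
the quadric. -/
lemma zeroLocus_hermGram_mem_sublines_iff [Finite F] (h : QuadraticCoords σ ζ μ re im)
    (hnorm : ∀ c : F, ∃ s : K, s * σ s = algebraMap F K c) {p : Fin 4 → F} (hp₀ : p ≠ 0) :
    zeroLocus σ (hermGram ζ p) ∈ sublines F K ↔ ellipticForm μ p ≠ 0 := by
  constructor
  · intro hB hp
    have h1 := ncard_of_mem_sublines hB
    have hs := Set.finite_of_ncard_pos (s := zeroLocus σ (hermGram ζ p)) (by omega)
    have := hs.to_subtype
    have h2 := Set.ncard_le_one_iff_subsingleton.2 (h.zeroLocus_subsingleton hp₀ hp)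
    have h3 := Nat.card_pos (α := F)
    omega
  · intro hp
    obtain ⟨x, y, z, hx, hy, hz, hxy, hxz, hyz⟩ := h.exists_three_zeros hnorm hp
    exact zeroLocus_mem_sublines h.conj_eq_iff (h.hermGram_ne_zero hp₀) hx hy hz hxy hxz hyz

/-- Every vector on the quadric is a multiple of a vector `ι t`. -/
lemma exists_eq_smul_quadricVec (h : QuadraticCoords σ ζ μ re im) {v : Fin 4 → F}
    (hv : ellipticForm μ v = 0) : ∃ (t : OnePoint K) (c : F), v = c • quadricVec μ re im t := by
  rw [ellipticForm_apply] at hv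
  by_cases h0 : v 0 = 0
  · obtain ⟨h1, h2⟩ := h.eq_zero_of_norm_eq_zero (x := v 1) (y := v 2) (by
      rw [h0] at hv; linear_combination -hv)
    refine ⟨OnePoint.infty, v 3, ?_⟩
    ext i
    fin_cases i <;> simp [quadricVec_infty, h0, h1, h2]
  · refine ⟨((algebraMap F K (v 1 / v 0) + algebraMap F K (v 2 / v 0) * ζ : K) : OnePoint K),
      v 0, ?_⟩
    rw [quadricVec_coe, (h.re_im_eq _ _).1, (h.re_im_eq _ _).2]
    ext i
    fin_cases i
    · simp
    · simp [mul_div_cancel₀ _ h0]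
    · simp [mul_div_cancel₀ _ h0]
    · simp
      field_simp
      linear_combination hv

lemma quadricVec_eq_of_smul (h : QuadraticCoords σ ζ μ re im) {s t : OnePoint K} {c : F}
    (hst : quadricVec μ re im s = c • quadricVec μ re im t) : s = t := by
  have h0 := congrFun hst 0
  have h1 := congrFun hst 1
  have h2 := congrFun hst 2
  have h3 := congrFun hst 3
  induction s using OnePoint.rec with
  | infty =>
    induction t using OnePoint.rec with
    | infty => rfl
    | coe t =>
      simp [quadricVec_infty, quadricVec_coe] at h0 h3
      simp [← h0] at h3
  | coe s =>
    induction t using OnePoint.rec with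
    | infty => simp [quadricVec_infty, quadricVec_coe] at h0
    | coe t =>
      simp [quadricVec_coe] at h0 h1 h2
      rw [← h0, one_mul] at h1 h2
      rw [h.decomp s, h.decomp t, h1, h2]

lemma quadricPoint_bijective (h : QuadraticCoords σ ζ μ re im) :
    Function.Bijective (quadricPoint (K := K) μ re im) := by
  constructor
  · intro s t hst
    obtain ⟨c, hc⟩ := (Projectivization.mk_eq_mk_iff' F _ _ _ _).1 (congrArg Subtype.val hst)
    exact h.quadricVec_eq_of_smul hc.symm
  · rintro ⟨P, hP⟩
    induction P with
    | h v hv =>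
      obtain ⟨t, c, hc⟩ := h.exists_eq_smul_quadricVec ((mem_quadric_iff hv).1 hP)
      exact ⟨t, Subtype.ext ((Projectivization.mk_eq_mk_iff' F _ _ _ _).2
        ⟨c⁻¹, by rw [hc, smul_smul, inv_mul_cancel₀ (by rintro rfl; simp [hc] at hv), one_smul]⟩)⟩

/-- A totally isotropic plane would meet `X₀ = 0` in the point `e₃`, which is not orthogonal to
any vector with `X₀ ≠ 0`. -/
theorem isEllipticForm (h : QuadraticCoords σ ζ μ re im) : IsEllipticForm (ellipticForm μ) := by
  have h2 := h.two_ne_zero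
  refine ⟨?_, ⟨_, (quadricPoint (K := K) μ re im OnePoint.infty).2⟩, fun W hW => ?_⟩
  · have : Invertible (2 : F) := invertibleOfNonzero h2
    rw [QuadraticMap.nondegenerate_iff_radical_eq_bot, QuadraticMap.radical_eq_ker_polarBilin,
      LinearMap.ker_eq_bot']
    exact fun p hp => polar_ne_zero h2 h.mu_ne_zero fun v => LinearMap.congr_fun hp v
  · by_contra! hiso
    have key : ∀ v ∈ W, v 0 = 0 → v = ![0, 0, 0, v 3] := by
      intro v hv h0
      have hv' := hiso v hv
      rw [ellipticForm_apply, h0] at hv'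
      obtain ⟨h1, h2⟩ := h.eq_zero_of_norm_eq_zero (x := v 1) (y := v 2)
        (by linear_combination -hv')
      ext i
      fin_cases i <;> simp [h0, h1, h2]
    -- the kernel of the coordinate `X₀` on `W` is not zero
    obtain ⟨w, hw, hw₀, hw0⟩ : ∃ w ∈ W, w ≠ 0 ∧ w 0 = 0 := by
      let f : W →ₗ[F] F := (LinearMap.proj 0).comp W.subtype
      have : LinearMap.ker f ≠ ⊥ :=
        LinearMap.ker_ne_bot_of_finrank_lt (by rw [hW, Module.finrank_self]; omega)
      obtain ⟨w, hw, hw₀⟩ := Submodule.exists_mem_ne_zero_of_ne_bot this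
      exact ⟨w, w.2, by simpa using hw₀, hw⟩
    have hw' := key w hw hw0
    have hw3 : w 3 ≠ 0 := by
      intro h3
      rw [h3] at hw'
      apply hw₀
      rw [hw']
      ext i
      fin_cases i <;> rfl
    have hall : ∀ v ∈ W, v 0 = 0 := by
      intro v hv
      have hp : QuadraticMap.polar (ellipticForm μ) w v = 0 := by
        simp [QuadraticMap.polar, hiso v hv, hiso w hw, hiso _ (W.add_mem hw hv)]
      rw [hw', polar_ellipticForm] at hp
      simpa [hw3] using hp
    have hle : W ≤ Submodule.span F {![0, 0, 0, 1]} := by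
      intro v hv
      rw [Submodule.mem_span_singleton]
      refine ⟨v 3, ?_⟩
      rw [key v hv (hall v hv)]
      ext i
      fin_cases i <;> simp
    have h1 := Submodule.finrank_mono hle
    have h3 := finrank_span_le_card (R := F) {(![0, 0, 0, 1] : Fin 4 → F)}
    simp at h3
    omega

/-- The non-tangent plane sections of the quadric are the images of the sublines. -/
theorem image_mem_planeSections_iff [Finite F] (h : QuadraticCoords σ ζ μ re im)
    (hnorm : ∀ c : F, ∃ s : K, s * σ s = algebraMap F K c) {f : OnePoint K ≃ quadric (ellipticForm μ)}
    (hf : ∀ t, f t = quadricPoint μ re im t) (B : Set (OnePoint K)) :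
    f '' B ∈ (planeSectionStructure (ellipticForm μ)).blocks ↔ B ∈ sublines F K := by
  have h2 := h.two_ne_zero
  have hμ := h.mu_ne_zero
  have hsec : ∀ (p : Fin 4 → F) (E : Submodule F (Fin 4 → F)),
      (∀ v, v ∈ E ↔ QuadraticMap.polar (ellipticForm μ) p v = 0) →
      f '' zeroLocus σ (hermGram ζ p) = {P | P.1.submodule ≤ E} := by
    intro p E hE
    ext P
    obtain ⟨t, rfl⟩ := f.surjective P
    rw [f.injective.mem_set_image, h.mem_zeroLocus_hermGram, ← hE]
    change _ ↔ (f t).1.submodule ≤ E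
    rw [hf, quadricPoint_submodule_le_iff]
  constructor
  · rintro ⟨E, hE, hEt, hB⟩
    obtain ⟨p, hp₀, hp⟩ := exists_plane_eq_polar h2 hμ E hE
    rw [isTangentPlane_iff h2 hμ hp₀ hp] at hEt
    rw [← hsec p E hp] at hB
    rw [f.injective.image_injective hB]
    exact (h.zeroLocus_hermGram_mem_sublines_iff hnorm hp₀).2 hEt
  · intro hB
    obtain ⟨M, hM₀, hM, rfl⟩ :=
      exists_hermitian_of_mem_sublines h.conj_conj h.conj_eq_iff h.ne_zero h.conj_eq hB
    obtain ⟨p, rfl⟩ := h.exists_hermGram_eq hM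
    have hp₀ : p ≠ 0 := by
      rintro rfl
      apply hM₀
      ext i j
      fin_cases i <;> fin_cases j <;> simp [hermGram]
    obtain ⟨E, hE, hEp⟩ := exists_plane_of_polar h2 hμ hp₀
    refine ⟨E, hE, ?_, hsec p E hEp⟩
    rw [isTangentPlane_iff h2 hμ hp₀ hEp]
    exact (h.zeroLocus_hermGram_mem_sublines_iff hnorm hp₀).1 hB

/-- The point map `ι` is an isomorphism from the complement of the Miquelian plane onto the
complements of the non-tangent plane sections. -/
theorem isIso_planeSections [Finite F] (h : QuadraticCoords σ ζ μ re im)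
    (hnorm : ∀ c : F, ∃ s : K, s * σ s = algebraMap F K c) {f : OnePoint K ≃ quadric (ellipticForm μ)}
    (hf : ∀ t, f t = quadricPoint μ re im t) :
    IncidenceStructure.IsIso f (miquelianPlane F K).complement
      (planeSectionStructure (ellipticForm μ)).complement := by
  ext T
  constructor
  · rintro ⟨_, ⟨B, hB, rfl⟩, rfl⟩
    exact ⟨f '' B, (h.image_mem_planeSections_iff hnorm hf B).2 hB, Set.image_compl_eq f.bijective⟩
  · rintro ⟨S, hS, rfl⟩
    refine ⟨_, ⟨f ⁻¹' S, ?_, rfl⟩, ?_⟩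
    · rw [← Set.image_preimage_eq S f.surjective] at hS
      exact (h.image_mem_planeSections_iff hnorm hf _).1 hS
    · rw [Set.image_compl_eq f.bijective, Set.image_preimage_eq S f.surjective]

/-- The words of the code of the quadric are the values of Hermitian forms. -/
theorem hasSublineZeros_columnCode [Finite K] (h : QuadraticCoords σ ζ μ re im)
    {f : OnePoint K ≃ quadric (ellipticForm μ)} (hf : ∀ t, f t = quadricPoint μ re im t)
    {g : quadric (ellipticForm μ) → Fin 4 → F} (hg : ∀ P, P.1.submodule = Submodule.span F {g P}) :
    HasSublineZeros F f.symm (columnCode g) := by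
  have h2 := h.two_ne_zero
  have hμ := h.mu_ne_zero
  have hgt : ∀ t, ∃ c : F, c ≠ 0 ∧ g (f t) = c • quadricVec μ re im t := by
    intro t
    have h1 := hg (f t)
    rw [hf, submodule_quadricPoint, Submodule.span_singleton_eq_span_singleton] at h1
    obtain ⟨c, hc⟩ := h1
    exact ⟨c, c.ne_zero, by rw [hf, ← hc]; rfl⟩
  have hword : ∀ (a : Fin 4 → F) (P : quadric (ellipticForm μ)),
      (LinearMap.pi fun P => Fintype.linearCombination F (g P) :
        (Fin 4 → F) →ₗ[F] (quadric (ellipticForm μ) → F)) a P = ∑ i, a i * g P i := by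
    intro a P
    simp [Fintype.linearCombination_apply]
  have hzero : ∀ (a p : Fin 4 → F),
      (∀ v, ∑ i, a i * v i = QuadraticMap.polar (ellipticForm μ) p v) →
      f.symm '' {P | ∑ i, a i * g P i = 0} = zeroLocus σ (hermGram ζ p) := by
    intro a p hap
    ext t
    obtain ⟨c, hc, hgc⟩ := hgt t
    rw [Equiv.image_symm_eq_preimage, h.mem_zeroLocus_hermGram, Set.mem_preimage]
    change ∑ i, a i * g (f t) i = 0 ↔ _
    rw [hap, hgc, QuadraticMap.polar_smul_right, smul_eq_mul, mul_eq_zero, or_iff_right hc]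
  constructor
  · rintro _ ⟨a, rfl⟩ hc₀
    simp only [hword]
    obtain ⟨p, hp₀, hp⟩ := exists_polar_eq h2 hμ a
    have ha : a ≠ 0 := by
      rintro rfl
      exact hc₀ (map_zero _)
    rw [← Set.ncard_image_of_injective _ f.symm.injective, hzero a p hp]
    exact ncard_zeroLocus_le_two_or_mem_sublines h.conj_eq_iff
      (h.hermGram_ne_zero fun hp => ha (hp₀ hp))
  · intro B hB
    obtain ⟨M, hM₀, hM, rfl⟩ :=
      exists_hermitian_of_mem_sublines h.conj_conj h.conj_eq_iff h.ne_zero h.conj_eq hB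
    obtain ⟨p, rfl⟩ := h.exists_hermGram_eq hM
    let a : Fin 4 → F := ![p 3, -2 * p 1, 2 * μ * p 2, p 0]
    have hap : ∀ v, ∑ i, a i * v i = QuadraticMap.polar (ellipticForm μ) p v := by
      intro v
      simp only [polar_ellipticForm, Fin.sum_univ_four, a, Matrix.cons_val]
      ring
    refine ⟨_, ⟨a, rfl⟩, fun h0 => ?_, ?_⟩
    · have h1 := hzero a p hap
      have h3 : {P | ∑ i, a i * g P i = 0} = Set.univ :=
        Set.eq_univ_of_forall fun P => (hword a P).symm.trans (congrFun h0 P)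
      rw [h3, Set.image_univ, f.symm.surjective.range_eq] at h1
      exact ne_univ_of_mem_sublines h.not_surjective hB h1.symm
    · simp only [hword]
      exact hzero a p hap

end QuadraticCoords
end Quadric

/-! ### Finite fields -/

section FiniteFields

lemma exists_frobenius (F R : Type*) [Field F] [Finite F] [CommRing R] [Algebra F R] :
    ∃ φ : R →ₐ[F] R, ∀ x, φ x = x ^ Nat.card F := by
  have := Fintype.ofFinite F
  exact ⟨FiniteField.frobeniusAlgHom F R, fun x => by
    rw [Nat.card_eq_fintype_card]; rfl⟩

/-- The fixed points of the `|F|`-power map are in `F`: they are roots of `X ^ |F| - X`, of which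
there are no more than `|F|`. -/
lemma mem_range_algebraMap_of_pow_card {F K : Type*} [Field F] [Finite F] [Field K] [Algebra F K]
    {x : K} (hx : x ^ Nat.card F = x) : x ∈ Set.range (algebraMap F K) := by
  classical
  have := Fintype.ofFinite F
  have h1 : 1 < Nat.card F := Finite.one_lt_card
  have hne := FiniteField.X_pow_card_sub_X_ne_zero K h1
  have hsub : Finset.univ.image (algebraMap F K) ⊆ (X ^ Nat.card F - X : K[X]).roots.toFinset := by
    intro y hy
    obtain ⟨z, -, rfl⟩ := Finset.mem_image.1 hy
    rw [Multiset.mem_toFinset, mem_roots hne, IsRoot.def]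
    simp [← map_pow, FiniteField.pow_card]
  have hcard : (X ^ Nat.card F - X : K[X]).roots.toFinset.card ≤
      (Finset.univ.image (algebraMap F K)).card := by
    rw [Finset.card_image_of_injective _ (algebraMap F K).injective, Finset.card_univ,
      ← Nat.card_eq_fintype_card]
    refine (Multiset.toFinset_card_le _).trans ((card_roots' _).trans ?_)
    rw [FiniteField.X_pow_card_sub_X_natDegree_eq K h1]
  have hmem : x ∈ (X ^ Nat.card F - X : K[X]).roots.toFinset := by
    rw [Multiset.mem_toFinset, mem_roots hne, IsRoot.def]
    rw [eval_sub, eval_pow, eval_X, hx, sub_self]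
  rw [← Finset.eq_of_subset_of_card_le hsub hcard] at hmem
  obtain ⟨z, -, hz⟩ := Finset.mem_image.1 hmem
  exact ⟨z, hz⟩

lemma two_ne_zero_of_odd_card {F : Type*} [Field F] [Finite F] (h : Odd (Nat.card F)) :
    (2 : F) ≠ 0 := by
  intro h2
  have := Fintype.ofFinite F
  obtain ⟨m, hm⟩ := h
  have h0 := FiniteField.cast_card_eq_zero F
  rw [Fintype.card_eq_nat_card, hm] at h0
  simp [h2] at h0

/-- The norm of a quadratic extension of finite fields is surjective. -/
lemma exists_mul_pow_card_eq {F K : Type*} [Field F] [Field K] [Algebra F K] [Finite K]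
    (hK : Nat.card K = Nat.card F ^ 2) (c : F) :
    ∃ s : K, s * s ^ Nat.card F = algebraMap F K c := by
  have : Finite F := Finite.of_injective _ (algebraMap F K).injective
  obtain ⟨s, hs⟩ := FiniteField.norm_surjective F K c
  refine ⟨s, ?_⟩
  have h1 : 1 < Nat.card F := Finite.one_lt_card
  have h2 : (Nat.card F ^ 2 - 1) / (Nat.card F - 1) = Nat.card F + 1 := by
    rw [← one_pow 2, Nat.sq_sub_sq, one_pow]
    exact Nat.mul_div_cancel _ (by omega)
  rw [← hs, FiniteField.algebraMap_norm_eq_pow, hK, h2, pow_succ, mul_comm]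

/-- The `q`-power map of the field with `q²` elements, for odd `q`, as conjugation. -/
lemma exists_quadraticCoords {F K : Type*} [Field F] [Field K] [Algebra F K] [Finite F]
    (hodd : Odd (Nat.card F)) (hK : Nat.card K = Nat.card F ^ 2) {σ : K →+* K}
    (hσ : ∀ x, σ x = x ^ Nat.card F) {ζ : K} (hζ₀ : ζ ≠ 0) (hζ : σ ζ = -ζ) {μ : F}
    (hμ : algebraMap F K μ = ζ ^ 2) : ∃ re im : K → F, QuadraticCoords σ ζ μ re im := by
  have h2 := two_ne_zero_of_odd_card hodd
  have h2K : (2 : K) ≠ 0 := by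
    rw [← map_ofNat (algebraMap F K) 2]
    exact (_root_.map_ne_zero (algebraMap F K)).2 h2
  have hfin : Finite K := Nat.finite_of_card_ne_zero (by
    rw [hK]; exact pow_ne_zero _ Nat.card_pos.ne')
  have := Fintype.ofFinite F
  have := Fintype.ofFinite K
  have hσσ : ∀ x, σ (σ x) = x := by
    intro x
    rw [hσ, hσ, ← pow_mul, ← pow_two, ← hK, ← Fintype.card_eq_nat_card, FiniteField.pow_card]
  have hrange : ∀ x, σ x = x → x ∈ Set.range (algebraMap F K) := fun x hx =>
    mem_range_algebraMap_of_pow_card (by rw [← hσ, hx])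
  have hre : ∀ t, ∃ x : F, algebraMap F K x = (t + σ t) / 2 := fun t => hrange _ (by
    rw [map_div₀, map_add, hσσ, map_ofNat, add_comm])
  have him : ∀ t, ∃ x : F, algebraMap F K x = (t - σ t) / (2 * ζ) := fun t => hrange _ (by
    rw [map_div₀, map_sub, hσσ, map_mul, map_ofNat, hζ, mul_neg, div_neg, ← neg_div, neg_sub])
  choose re hre using hre
  choose im him using him
  refine ⟨re, im, h2, fun x => ?_, hζ₀, hζ, hμ, fun t => ?_⟩
  · rw [hσ, ← map_pow, ← Fintype.card_eq_nat_card, FiniteField.pow_card]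
  · rw [hre, him]
    field_simp
    ring

end FiniteFields

/-! ### Negacyclic codes -/

section Negacyclic

variable {K L : Type*} [Field K] [Field L] [Algebra K L]

/-- A word whose coordinates are `∑ aⱼ βⱼ⁻ⁱ` for roots `βⱼ` of `h` with `βⱼ ^ n = -1` is in the
code with check polynomial `h`: up to a constant, the polynomial of the word `i ↦ β⁻ⁱ` is
`(X ^ n + 1) / (X - β)`. -/
lemma mem_negacyclicCode_of_roots {ι : Type*} [Fintype ι] {n : ℕ} (hn₀ : n ≠ 0) {h : K[X]} {β a : ι → L}
    (hβ : ∀ j, aeval (β j) h = 0) (hn : ∀ j, β j ^ n = -1) {c : Fin n → K}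
    (hc : ∀ i, algebraMap K L (c i) = ∑ j, a j * ((β j)⁻¹) ^ (i : ℕ)) : c ∈ negacyclicCode n h := by
  change X ^ n + 1 ∣ h * wordPolynomial c
  rw [← map_dvd_map' (algebraMap K L)]
  simp only [Polynomial.map_add, Polynomial.map_pow, Polynomial.map_mul, map_X, Polynomial.map_one]
  have hword : (wordPolynomial c).map (algebraMap K L) =
      ∑ j, C (a j) * ∑ i ∈ Finset.range n, (C (β j)⁻¹ * X) ^ i := by
    simp only [wordPolynomial, Polynomial.map_sum, Polynomial.map_mul, map_C, Polynomial.map_pow,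
      map_X, hc, map_sum, map_mul, map_pow, Finset.sum_mul, Finset.mul_sum]
    rw [Finset.sum_comm]
    refine Finset.sum_congr rfl fun j _ => ?_
    rw [Finset.sum_range]
    refine Finset.sum_congr rfl fun i _ => ?_
    rw [mul_pow, mul_assoc]
  rw [hword, Finset.mul_sum]
  refine Finset.dvd_sum fun j _ => ?_
  have hβ0 : β j ≠ 0 := by
    intro h0
    have h1 := hn j
    rw [h0] at h1
    rw [zero_pow hn₀] at h1
    simp at h1
  obtain ⟨g, hg⟩ : (X - C (β j)) ∣ h.map (algebraMap K L) := by
    rw [dvd_iff_isRoot, IsRoot.def, eval_map_algebraMap]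
    exact hβ j
  have hgeom := geom_sum_mul (C (β j)⁻¹ * X) n
  have hlin : (X - C (β j) : L[X]) = C (β j) * (C (β j)⁻¹ * X - 1) := by
    rw [mul_sub, ← mul_assoc, ← C_mul, mul_inv_cancel₀ hβ0, C_1, one_mul, mul_one]
  have hpow : (C (β j)⁻¹ * X : L[X]) ^ n - 1 = -(X ^ n + 1) := by
    rw [mul_pow, ← C_pow, inv_pow, hn]
    simp
    ring
  rw [hpow] at hgeom
  refine ⟨-g * C (a j) * C (β j), ?_⟩
  rw [hg, hlin]
  linear_combination C (β j) * g * C (a j) * hgeom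

lemma coeff_wordPolynomial {n : ℕ} (c : Fin n → K) (i : Fin n) :
    (wordPolynomial c).coeff i = c i := by
  simp [wordPolynomial, coeff_X_pow, Fin.val_inj]

lemma degree_wordPolynomial_lt {n : ℕ} (c : Fin n → K) : (wordPolynomial c).degree < n := by
  rw [wordPolynomial]
  refine (degree_sum_le _ _).trans_lt ((Finset.sup_lt_iff (WithBot.bot_lt_coe n)).2 fun i _ => ?_)
  exact (degree_C_mul_X_pow_le _ _).trans_lt (Nat.cast_lt.2 i.2)

/-- A word of a negacyclic code with check polynomial of degree at most `d` satisfies a linear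
recurrence of order `d`, so it is determined by its first `d` coordinates. -/
lemma eq_zero_of_mem_negacyclicCode {n d : ℕ} {h : K[X]} (hh : h ≠ 0) (hd : h.natDegree ≤ d)
    {c : Fin n → K} (hc : c ∈ negacyclicCode n h)
    (hzero : ∀ i : Fin n, (i : ℕ) < d → c i = 0) : c = 0 := by
  by_contra hc₀
  have hn : 0 < n := by
    rcases Nat.eq_zero_or_pos n with rfl | hpos
    · exact absurd (Subsingleton.elim c 0) hc₀
    · exact hpos
  have hP : wordPolynomial c ≠ 0 := by
    intro h0
    apply hc₀
    ext i
    rw [← coeff_wordPolynomial c i, h0, coeff_zero, Pi.zero_apply]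
  have hdeg := degree_wordPolynomial_lt c
  rw [degree_eq_natDegree hP, Nat.cast_lt] at hdeg
  obtain ⟨G, hG⟩ := hc
  have hXn : (X ^ n + 1 : K[X]).natDegree = n := by
    rw [← C_1, natDegree_X_pow_add_C]
  have hG₀ : G ≠ 0 := by
    rintro rfl
    rw [mul_zero] at hG
    exact mul_ne_zero hh hP hG
  have hX₀ : (X ^ n + 1 : K[X]) ≠ 0 := by
    intro h0
    rw [h0, natDegree_zero] at hXn
    omega
  have hdegs := congrArg natDegree hG
  rw [natDegree_mul hh hP, natDegree_mul hX₀ hG₀, hXn] at hdegs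
  have hXd : (X ^ d : K[X]) ∣ wordPolynomial c := by
    rw [X_pow_dvd_iff]
    intro i hi
    by_cases hin : i < n
    · rw [show i = ((⟨i, hin⟩ : Fin n) : ℕ) from rfl, coeff_wordPolynomial]
      exact hzero _ hi
    · exact coeff_eq_zero_of_natDegree_lt (by omega)
  have hcop : IsCoprime (X ^ d : K[X]) (X ^ n + 1) := by
    refine IsCoprime.pow_left ⟨-X ^ (n - 1), 1, ?_⟩
    have : (X : K[X]) ^ n = X ^ (n - 1) * X := by rw [← pow_succ, Nat.sub_add_cancel hn]
    rw [this]
    ring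
  have hXG : (X ^ d : K[X]) ∣ G :=
    hcop.dvd_of_dvd_mul_left (hG ▸ Dvd.dvd.mul_left hXd h)
  have := natDegree_le_of_dvd hXG hG₀
  rw [natDegree_X_pow] at this
  omega

end Negacyclic

/-! ### The unit circle -/

section UnitCircle

/-- An injective map from `n` points into the unit circle is onto, since there are at most `n` roots
of unity of order dividing `n`. -/
lemma bijOn_unitCircle {L α : Type*} [Field L] {n : ℕ} (hn : 0 < n) (hα : Nat.card α = n)
    {f : α → L} (hf : Function.Injective f) (hmem : ∀ a, f a ^ n = 1) :
    Set.BijOn f Set.univ (unitCircle L n) := by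
  have hfin : unitCircle L n = ↑(nthRootsFinset n (1 : L)) := by
    ext u
    simp [unitCircle, mem_nthRootsFinset hn]
  have hle : (unitCircle L n).ncard ≤ n := by
    classical
    rw [hfin, Set.ncard_coe_finset, nthRootsFinset_def]
    exact (Multiset.toFinset_card_le _).trans (card_nthRoots n 1)
  have hsub : f '' Set.univ ⊆ unitCircle L n := by
    rintro _ ⟨a, -, rfl⟩
    exact hmem a
  refine ⟨fun a _ => hmem a, hf.injOn, ?_⟩
  refine (Set.eq_of_subset_of_ncard_le hsub ?_ (hfin ▸ Finset.finite_toSet _)).ge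
  rwa [Set.ncard_image_of_injective _ hf, Set.ncard_univ, hα]

lemma pow_half_order {L : Type*} [Field L] {n : ℕ} (hn : 0 < n) {δ : L} (hδ : orderOf δ = 2 * n) :
    δ ^ n = -1 := by
  have h1 : (δ ^ n) ^ 2 = 1 := by
    rw [← pow_mul, mul_comm, ← hδ, pow_orderOf_eq_one]
  rcases mul_self_eq_one_iff.1 ((pow_two _).symm.trans h1) with h | h
  · exact absurd (orderOf_dvd_of_pow_eq_one h) (by rw [hδ]; exact Nat.not_dvd_of_pos_of_lt hn (by omega))
  · exact h

/-- The order of `δ ^ (q + 1)` is `n = q² + 1`: half of `q + 1` is prime to `n`. -/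
lemma transport_bijOn {L : Type*} [Field L] {q : ℕ} (hq : q % 4 = 1) {δ : L}
    (hδ : orderOf δ = 2 * (q ^ 2 + 1)) :
    Set.BijOn (transport q (q ^ 2 + 1) δ) Set.univ (unitCircle L (q ^ 2 + 1)) := by
  obtain ⟨k, rfl⟩ : ∃ k, q = 4 * k + 1 := ⟨q / 4, by omega⟩
  set n := (4 * k + 1) ^ 2 + 1 with hn
  have hδ' : orderOf δ⁻¹ = 2 * n := by
    rw [← hδ]
    exact orderOf_eq_orderOf_iff.2 fun m => by rw [inv_pow, inv_eq_one]
  have hδ₀ : δ⁻¹ ≠ 0 := by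
    intro h0
    rw [h0, orderOf_zero] at hδ'
    omega
  have hcop : n.Coprime (2 * k + 1) := by
    have : n = 2 + (2 * k + 1) * (8 * k) := by rw [hn]; ring
    rw [this, Nat.coprime_add_mul_left_left]
    exact (Nat.coprime_two_left).2 ⟨k, rfl⟩
  refine bijOn_unitCircle (by omega) (Nat.card_fin n) ?_ ?_
  · intro i j hij
    simp only [transport, ← pow_mul] at hij
    have key : ∀ {i j : Fin n}, (i : ℕ) ≤ j →
        δ⁻¹ ^ ((i : ℕ) * (4 * k + 1 + 1)) = δ⁻¹ ^ ((j : ℕ) * (4 * k + 1 + 1)) → i = j := by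
      intro i j hle h
      have h2 : 2 * n ∣ (j : ℕ) * (4 * k + 1 + 1) - i * (4 * k + 1 + 1) := by
        rw [← hδ']
        refine orderOf_dvd_of_pow_eq_one (mul_left_cancel₀
          (pow_ne_zero ((i : ℕ) * (4 * k + 1 + 1)) hδ₀) ?_)
        rw [← pow_add, Nat.add_sub_cancel' (Nat.mul_le_mul_right _ hle), ← h, mul_one]
      rw [← Nat.sub_mul, show ((j : ℕ) - i) * (4 * k + 1 + 1) = 2 * (((j : ℕ) - i) * (2 * k + 1)) by
        ring] at h2
      have h3 := hcop.dvd_of_dvd_mul_right (Nat.dvd_of_mul_dvd_mul_left two_pos h2)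
      have h4 := Nat.eq_zero_of_dvd_of_lt h3 (by omega)
      exact Fin.ext (by omega)
    rcases le_total (i : ℕ) j with hle | hle
    · exact key hle hij
    · exact (key hle hij.symm).symm
  · intro i
    have h1 : (δ⁻¹) ^ (2 * n) = 1 := by rw [← hδ', pow_orderOf_eq_one]
    rw [transport, ← pow_mul, ← pow_mul, show (i : ℕ) * ((4 * k + 1 + 1) * n) =
      2 * n * ((i : ℕ) * (2 * k + 1)) by ring, pow_mul, h1, one_pow]

variable {K L : Type*} [Field K] [Field L] [Algebra K L]

@[simp] lemma cayleyMap_infty (ω : L) : cayleyMap (K := K) ω OnePoint.infty = 1 := rfl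

@[simp] lemma cayleyMap_coe (ω : L) (t : K) :
    cayleyMap ω (t : OnePoint K) = (algebraMap K L t + ω) / (algebraMap K L t - ω) := rfl

/-- `ω` is not in `K`, since it is not fixed by the `|K|`-power map. -/
lemma algebraMap_sub_ne_zero [Finite K] (h2 : (2 : L) ≠ 0) {ω : L} (hω₀ : ω ≠ 0)
    (hω : ω ^ Nat.card K = -ω) (t : K) : algebraMap K L t - ω ≠ 0 := by
  intro h
  have := Fintype.ofFinite K
  rw [← sub_eq_zero.1 h, ← map_pow, ← Fintype.card_eq_nat_card, FiniteField.pow_card,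
    sub_eq_zero.1 h] at hω
  have h3 : 2 * ω = 0 := by linear_combination hω
  exact hω₀ (by simpa [h2] using h3)

lemma cayleyMap_bijOn [Finite K] (h2 : (2 : L) ≠ 0) {ω : L} (hω₀ : ω ≠ 0)
    (hω : ω ^ Nat.card K = -ω) :
    Set.BijOn (cayleyMap (K := K) ω) Set.univ (unitCircle L (Nat.card K + 1)) := by
  have hne := algebraMap_sub_ne_zero (K := K) h2 hω₀ hω
  refine bijOn_unitCircle (Nat.succ_pos _) Finite.card_option ?_ ?_
  · have h1 : ∀ t : K, (algebraMap K L t + ω) / (algebraMap K L t - ω) ≠ 1 := by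
      intro t h
      rw [div_eq_one_iff_eq (hne t)] at h
      have h3 : 2 * ω = 0 := by linear_combination h
      exact hω₀ (by simpa [h2] using h3)
    intro s t h
    induction s using OnePoint.rec with
    | infty =>
      induction t using OnePoint.rec with
      | infty => rfl
      | coe t => exact absurd h.symm (h1 t)
    | coe s =>
      induction t using OnePoint.rec with
      | infty => exact absurd h (h1 s)
      | coe t =>
        rw [cayleyMap_coe, cayleyMap_coe, div_eq_div_iff (hne s) (hne t)] at h
        have h3 : 2 * ω * (algebraMap K L t - algebraMap K L s) = 0 := by linear_combination h
        have h4 : algebraMap K L t = algebraMap K L s := by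
          simpa [h2, hω₀, sub_eq_zero] using h3
        rw [(algebraMap K L).injective h4]
  · intro t
    induction t using OnePoint.rec with
    | infty => simp
    | coe t =>
      obtain ⟨φ, hφ⟩ := exists_frobenius K L
      have hplus : algebraMap K L t + ω ≠ 0 := by
        intro h
        apply hne (-t)
        rw [map_neg]
        linear_combination -h
      rw [cayleyMap_coe, pow_succ, ← hφ, map_div₀, map_add, map_sub, AlgHom.commutes, hφ ω, hω]
      have := hne t
      rw [sub_neg_eq_add, ← sub_eq_add_neg]
      field_simp

end UnitCircle

/-! ### The words of the negacyclic code as sesquilinear forms -/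

section CodeWords

variable {K L : Type*} [Field K] [Field L] [Algebra K L]

/-- The coefficients by which the word of the sesquilinear form with Gram matrix `M` is written as a
combination of powers of `δ⁻¹`; the four coefficients are obtained from the four choices of the
signs of `ω` and `ω'`. -/
noncomputable def cayleyCoeff (ω ω' : L) (M : Matrix (Fin 2) (Fin 2) K) : L :=
  (algebraMap K L (M 0 0) + algebraMap K L (M 0 1) / ω' + algebraMap K L (M 1 0) / ω +
    algebraMap K L (M 1 1) / (ω * ω')) / 4

lemma cayleyCoeff_sub (ω ω' : L) (M M' : Matrix (Fin 2) (Fin 2) K) :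
    cayleyCoeff ω ω' (M - M') = cayleyCoeff ω ω' M - cayleyCoeff ω ω' M' := by
  simp only [cayleyCoeff, Matrix.sub_apply, map_sub]
  ring

lemma algHom_cayleyCoeff (φ : L →ₐ[K] L) (ω ω' : L) (M : Matrix (Fin 2) (Fin 2) K) :
    φ (cayleyCoeff ω ω' M) = cayleyCoeff (φ ω) (φ ω') M := by
  simp only [cayleyCoeff, map_div₀, map_add, map_mul, AlgHom.commutes, map_ofNat]

/-- The sesquilinear form with Gram matrix `M` in the coordinate `u = (t + ω) / (t - ω)`: its value
in the coordinate `t` is `(t - ω) (t - ω) ^ q` times this function of `u`. -/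
noncomputable def cayleyForm (q : ℕ) (ω : L) (M : Matrix (Fin 2) (Fin 2) K) (u : L) : L :=
  cayleyCoeff ω (-ω ^ q) M * u + cayleyCoeff (-ω) (ω ^ q) M * u ^ q +
    cayleyCoeff ω (ω ^ q) M * u ^ (q + 1) + cayleyCoeff (-ω) (-ω ^ q) M

lemma cayleyForm_eq_zero_iff [Finite K] {q : ℕ} (h2 : (2 : L) ≠ 0) {ω : L} (hω₀ : ω ≠ 0)
    (hω : ω ^ Nat.card K = -ω) {σ : K →+* K} (hσ : ∀ x, σ x = x ^ q) {φ : L →+* L}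
    (hφ : ∀ x, φ x = x ^ q) (M : Matrix (Fin 2) (Fin 2) K) (x : OnePoint K) :
    cayleyForm q ω M (cayleyMap ω x) = 0 ↔ x ∈ zeroLocus σ M := by
  have h4 : (4 : L) ≠ 0 := by
    have : (4 : L) = 2 * 2 := by norm_num
    rw [this]
    exact mul_ne_zero h2 h2
  have hω' : ω ^ q ≠ 0 := pow_ne_zero q hω₀
  induction x using OnePoint.rec with
  | infty =>
    rw [infty_mem_zeroLocus, ← map_eq_zero (algebraMap K L)]
    refine Eq.congr_left ?_
    rw [cayleyMap_infty]
    simp only [cayleyForm, cayleyCoeff, one_pow, mul_one]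
    field_simp
    ring
  | coe t =>
    have hne := algebraMap_sub_ne_zero (K := K) h2 hω₀ hω t
    have hne' : algebraMap K L t ^ q - ω ^ q ≠ 0 := by
      rw [← hφ, ← hφ, ← map_sub]
      exact (_root_.map_ne_zero φ).2 hne
    have hu : cayleyMap ω (t : OnePoint K) ^ q =
        (algebraMap K L t ^ q + ω ^ q) / (algebraMap K L t ^ q - ω ^ q) := by
      rw [← hφ, cayleyMap_coe, map_div₀, map_add, map_sub, hφ, hφ]
    have key : algebraMap K L (M 0 0 * (t * σ t) + M 0 1 * t + M 1 0 * σ t + M 1 1) =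
        cayleyForm q ω M (cayleyMap ω (t : OnePoint K)) *
          ((algebraMap K L t - ω) * (algebraMap K L t ^ q - ω ^ q)) := by
      rw [cayleyForm, pow_succ, hu, cayleyMap_coe]
      simp only [cayleyCoeff, map_add, map_mul, hσ, map_pow]
      generalize algebraMap K L t ^ q = s at *
      generalize ω ^ q = ω' at *
      field_simp
      ring
    rw [coe_mem_zeroLocus, ← map_eq_zero (algebraMap K L), key, mul_eq_zero,
      or_iff_left (mul_ne_zero hne hne')]

end CodeWords

/-! ### The negacyclic code -/

section Code

variable {F K L : Type*} [Field F] [Field K] [Field L] [Algebra F K] [Algebra K L]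

/-- The roots of the check polynomial of `C(1, q² + q + 1)`: `δ`, `δ ^ (q² + q + 1)` and their
conjugates over `K`. -/
def checkRoots (q : ℕ) (δ : L) : Fin 4 → L :=
  ![δ, δ ^ q ^ 2, δ ^ (q ^ 2 + q + 1), (δ ^ (q ^ 2 + q + 1)) ^ q ^ 2]

/-- The coefficients of the word of the form with Gram matrix `M` at the powers of the inverses of
the roots of the check polynomial. -/
noncomputable def wordCoeffs (q : ℕ) (ω : L) (M : Matrix (Fin 2) (Fin 2) K) : Fin 4 → L :=
  ![cayleyCoeff ω (-ω ^ q) M, cayleyCoeff (-ω) (ω ^ q) M, cayleyCoeff ω (ω ^ q) M,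
    cayleyCoeff (-ω) (-ω ^ q) M]

/-- The combination of powers with the coefficients `wordCoeffs` is fixed by the `q²`-power map, so
its values are in `K`. -/
lemma exists_word [Finite K] {q : ℕ} (hK : Nat.card K = q ^ 2) (hL : Nat.card L = q ^ 4)
    (hodd : Odd q) (δ : L) {ω : L} (hω : ω ^ q ^ 2 = -ω) (M : Matrix (Fin 2) (Fin 2) K) (i : ℕ) :
    ∃ y : K, algebraMap K L y = ∑ j, wordCoeffs q ω M j * (checkRoots q δ j)⁻¹ ^ i := by
  obtain ⟨φ, hφ⟩ := exists_frobenius K L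
  rw [hK] at hφ
  have hfin : Finite L := Nat.finite_of_card_ne_zero (by
    rw [hL]; exact pow_ne_zero _ hodd.pos.ne')
  have := Fintype.ofFinite L
  have hφφ : ∀ x : L, (x ^ q ^ 2) ^ q ^ 2 = x := by
    intro x
    rw [← pow_mul, ← pow_add, ← hL, ← Fintype.card_eq_nat_card, FiniteField.pow_card]
  have hφω : φ ω = -ω := (hφ ω).trans hω
  have hφω' : φ (ω ^ q) = -ω ^ q := by rw [map_pow, hφω, hodd.neg_pow]
  refine mem_range_algebraMap_of_pow_card ?_
  rw [hK, ← hφ]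
  simp only [Fin.sum_univ_four, wordCoeffs, checkRoots, Matrix.cons_val]
  generalize δ ^ (q ^ 2 + q + 1) = η
  rw [← hφ δ, ← hφ η]
  have hδδ : φ (φ δ) = δ := by rw [hφ, hφ, hφφ]
  have hηη : φ (φ η) = η := by rw [hφ, hφ, hφφ]
  simp only [map_add, map_mul, algHom_cayleyCoeff, map_neg, hφω, hφω', map_pow φ _ i, map_inv₀,
    neg_neg, hδδ, hηη]
  ring

/-- Multiplication by `x ^ q` turns the powers of `x = δ⁻ⁱ` in a word into powers of
`u = x ^ (q + 1)`; the last of them is `1` because `x ^ (q² + 1) = ±1` and `q + 1` is even. -/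
lemma mul_word_eq_cayleyForm {q : ℕ} (hodd : Odd q) {δ : L} (hδ : δ ^ (q ^ 2 + 1) = -1) {ω : L}
    (M : Matrix (Fin 2) (Fin 2) K) (i : Fin (q ^ 2 + 1)) :
    (δ⁻¹ ^ (i : ℕ)) ^ q * ∑ j, wordCoeffs q ω M j * (checkRoots q δ j)⁻¹ ^ (i : ℕ) =
      cayleyForm q ω M (transport q (q ^ 2 + 1) δ i) := by
  set x := δ⁻¹ ^ (i : ℕ) with hx
  have hinv : ∀ m : ℕ, (δ ^ m)⁻¹ ^ (i : ℕ) = x ^ m := by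
    intro m
    rw [hx, ← inv_pow, ← pow_mul, ← pow_mul, mul_comm]
  have hxn : (x ^ (q ^ 2 + 1)) ^ (q + 1) = 1 := by
    have h1 : x ^ (q ^ 2 + 1) = (-1) ^ (i : ℕ) := by
      rw [hx, ← pow_mul, mul_comm, pow_mul, inv_pow, hδ, inv_neg_one]
    rw [h1, ← pow_mul, mul_comm, pow_mul, hodd.add_one.neg_one_pow, one_pow]
  simp only [Fin.sum_univ_four, wordCoeffs, checkRoots, Matrix.cons_val, cayleyForm, transport,
    ← pow_mul δ, hinv, ← hx]
  have e4 : x ^ q * x ^ ((q ^ 2 + q + 1) * q ^ 2) = 1 := by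
    rw [← pow_add, show q + (q ^ 2 + q + 1) * q ^ 2 = (q ^ 2 + 1) * (q + 1) * q by ring,
      pow_mul, pow_mul, hxn, one_pow]
  linear_combination cayleyCoeff (-ω) (-ω ^ q) M * e4

/-- The negacyclic code `C(1, q² + q + 1)` consists of the words of the sesquilinear forms, so its
zero sets are their isotropic loci. -/
theorem hasSublineZeros_negacyclicCodeC {q : ℕ} (hq : q % 4 = 1) (hF : Nat.card F = q)
    (hK : Nat.card K = q ^ 2) (hL : Nat.card L = q ^ 4) {δ : L}
    (hδ : orderOf δ = 2 * (q ^ 2 + 1)) {ω : L} (hω₀ : ω ≠ 0) (hω : ω ^ q ^ 2 = -ω)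
    {e : Fin (q ^ 2 + 1) ≃ OnePoint K}
    (he : ∀ i, cayleyMap ω (e i) = transport q (q ^ 2 + 1) δ i) :
    HasSublineZeros F e (negacyclicCodeC K (q ^ 2 + 1) δ 1 (q ^ 2 + q + 1)) := by
  have hq0 : q ≠ 0 := by rintro rfl; simp at hq
  have hodd : Odd q := Nat.odd_iff.2 (by omega)
  have hfinF : Finite F := Nat.finite_of_card_ne_zero (by rwa [hF])
  have hfinK : Finite K := Nat.finite_of_card_ne_zero (by rw [hK]; exact pow_ne_zero _ hq0)
  have hfinL : Finite L := Nat.finite_of_card_ne_zero (by rw [hL]; exact pow_ne_zero _ hq0)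
  have hq5 : 5 ≤ q := by
    have := Finite.one_lt_card (α := F)
    omega
  have hsq : 5 * q ≤ q ^ 2 := by nlinarith
  have h2 : (2 : L) ≠ 0 := two_ne_zero_of_odd_card (by rw [hL]; exact hodd.pow)
  obtain ⟨σ', hσ'⟩ := exists_frobenius F K
  obtain ⟨σ, hσ⟩ : ∃ σ : K →+* K, ∀ x, σ x = x ^ Nat.card F := ⟨σ', hσ'⟩
  obtain ⟨τ, hτ⟩ := exists_frobenius K L
  let _ : Algebra F L := ((algebraMap K L).comp (algebraMap F K)).toAlgebra
  obtain ⟨φ, hφ⟩ := exists_frobenius F L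
  rw [hF] at hσ hφ
  rw [hK] at hτ
  have hfix : ∀ t, σ t = t ↔ t ∈ Set.range (algebraMap F K) := by
    intro t
    refine ⟨fun ht => mem_range_algebraMap_of_pow_card (by rw [hF, ← hσ]; exact ht), ?_⟩
    rintro ⟨x, rfl⟩
    rw [hσ, ← hF, ← hσ', AlgHom.commutes]
  have hns : ¬ Function.Surjective (algebraMap F K) := by
    intro hs
    have := Nat.card_le_card_of_surjective _ hs
    rw [hF, hK] at this
    omega
  have hδn := pow_half_order (Nat.succ_pos _) hδ
  have hδ₀ : δ ≠ 0 := by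
    rintro rfl
    simp at hδn
  -- the words of the forms
  choose w hw using fun (M : Matrix (Fin 2) (Fin 2) K) (i : Fin (q ^ 2 + 1)) =>
    exists_word hK hL hodd δ hω M i
  have hzero : ∀ M i, w M i = 0 ↔ e i ∈ zeroLocus σ M := by
    intro M i
    rw [← cayleyForm_eq_zero_iff (φ := (φ : L →+* L)) h2 hω₀ (by rw [hK, hω]) hσ hφ, he,
      ← mul_word_eq_cayleyForm hodd hδn, ← hw, mul_eq_zero, map_eq_zero,
      or_iff_right (pow_ne_zero _ (pow_ne_zero _ (inv_ne_zero hδ₀)))]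
  have himage : ∀ M, e '' {i | w M i = 0} = zeroLocus σ M := by
    intro M
    ext x
    obtain ⟨i, rfl⟩ := e.surjective x
    rw [e.injective.mem_set_image]
    exact hzero M i
  have hwsub : ∀ M M', w (M - M') = w M - w M' := by
    intro M M'
    ext i
    apply (algebraMap K L).injective
    rw [Pi.sub_apply, map_sub, hw, hw, hw, ← Finset.sum_sub_distrib]
    refine Finset.sum_congr rfl fun j _ => ?_
    rw [← sub_mul]
    congr 1
    fin_cases j <;> simp [wordCoeffs, cayleyCoeff_sub]
  have hwne : ∀ M, M ≠ 0 → w M ≠ 0 := by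
    intro M hM h0
    have h1 := himage M
    rw [h0] at h1
    simp only [Pi.zero_apply, Set.ofPred_true, Set.image_univ, e.surjective.range_eq] at h1
    rcases ncard_zeroLocus_le_two_or_mem_sublines hfix hM with h3 | h3
    · rw [← h1, Set.ncard_univ, ← Nat.card_congr e, Nat.card_fin] at h3
      omega
    · exact ne_univ_of_mem_sublines hns h3 h1.symm
  have hwinj : ∀ M M', w M = w M' → M = M' := by
    intro M M' h
    by_contra hne
    exact hwne (M - M') (sub_ne_zero.2 hne) (by rw [hwsub, h, sub_self])
  -- the check polynomial
  set h := minpoly K (δ ^ 1) * minpoly K (δ ^ (q ^ 2 + q + 1)) with hh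
  have hfd : Module.Finite K L := Module.Finite.of_finite
  have hrank : Module.finrank K L = 2 := by
    have h1 := Module.natCard_eq_pow_finrank (K := K) (V := L)
    rw [hK, hL, ← pow_mul] at h1
    have := Nat.pow_right_injective (by omega : 2 ≤ q) h1
    omega
  have hh₀ : h ≠ 0 := mul_ne_zero (minpoly.ne_zero (Algebra.IsIntegral.isIntegral _))
    (minpoly.ne_zero (Algebra.IsIntegral.isIntegral _))
  have hdeg : h.natDegree ≤ 4 := by
    have h1 := minpoly.natDegree_le (A := K) (δ ^ 1)
    have h3 := minpoly.natDegree_le (A := K) (δ ^ (q ^ 2 + q + 1))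
    rw [hrank] at h1 h3
    exact natDegree_mul_le.trans (add_le_add h1 h3)
  have hroot : ∀ β : L, aeval (β ^ q ^ 2) (minpoly K β) = 0 := by
    intro β
    rw [← hτ, aeval_algHom_apply, minpoly.aeval, map_zero]
  have hmem : ∀ M, w M ∈ negacyclicCode (q ^ 2 + 1) h := by
    intro M
    refine mem_negacyclicCode_of_roots (Nat.succ_ne_zero _) (β := checkRoots q δ)
      (fun j => ?_) (fun j => ?_) (hw M)
    · rw [hh, map_mul, mul_eq_zero, pow_one]
      fin_cases j
      · exact Or.inl (minpoly.aeval K δ)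
      · exact Or.inl (hroot δ)
      · exact Or.inr (minpoly.aeval K _)
      · exact Or.inr (hroot _)
    · have hoddQ : Odd (q ^ 2) := hodd.pow
      have hoddr : Odd (q ^ 2 + q + 1) := (hoddQ.add_odd hodd).add_one
      have hpow : ∀ (β : L) (m : ℕ), β ^ (q ^ 2 + 1) = -1 → Odd m → (β ^ m) ^ (q ^ 2 + 1) = -1 := by
        intro β m hβ hm
        rw [← pow_mul, mul_comm, pow_mul, hβ, hm.neg_one_pow]
      fin_cases j
      · exact hδn
      · exact hpow _ _ hδn hoddQ
      · exact hpow _ _ hδn hoddr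
      · exact hpow _ _ (hpow _ _ hδn hoddr) hoddQ
  -- a word is determined by four coordinates, and there are as many forms as quadruples
  have hsurj : ∀ c ∈ negacyclicCode (q ^ 2 + 1) h, ∃ M, w M = c := by
    intro c hc
    have hlt : 4 ≤ q ^ 2 + 1 := by omega
    let T : Matrix (Fin 2) (Fin 2) K → Fin 4 → K := fun M i => w M (Fin.castLE hlt i)
    have hext : ∀ c d, c ∈ negacyclicCode (q ^ 2 + 1) h → d ∈ negacyclicCode (q ^ 2 + 1) h →
        (∀ i : Fin 4, c (Fin.castLE hlt i) = d (Fin.castLE hlt i)) → c = d := by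
      intro c d hc hd hcd
      rw [← sub_eq_zero]
      refine eq_zero_of_mem_negacyclicCode hh₀ hdeg (Submodule.sub_mem _ hc hd) fun i hi => ?_
      rw [Pi.sub_apply, sub_eq_zero]
      exact hcd ⟨i, hi⟩
    have hT : Function.Injective T := fun M M' hMM' =>
      hwinj M M' (hext _ _ (hmem M) (hmem M') fun i => congrFun hMM' i)
    have hcard : Nat.card (Fin 4 → K) ≤ Nat.card (Matrix (Fin 2) (Fin 2) K) := by
      have : Nat.card (Matrix (Fin 2) (Fin 2) K) = Nat.card (Fin 2 → Fin 2 → K) := rfl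
      rw [this]
      simp only [Nat.card_fun, Nat.card_fin, ← pow_mul]
      exact le_rfl
    have : Finite (Matrix (Fin 2) (Fin 2) K) := inferInstanceAs (Finite (Fin 2 → Fin 2 → K))
    obtain ⟨M, hM⟩ := (hT.bijective_of_nat_card_le hcard).2 fun i => c (Fin.castLE hlt i)
    exact ⟨M, hext _ _ (hmem M) hc fun i => congrFun hM i⟩
  constructor
  · intro c hc hc₀
    obtain ⟨M, rfl⟩ := hsurj c hc
    have hM : M ≠ 0 := by
      rintro rfl
      apply hc₀
      rw [← sub_self (0 : Matrix (Fin 2) (Fin 2) K), hwsub, sub_self]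
    rw [← Set.ncard_image_of_injective _ e.injective, himage]
    exact ncard_zeroLocus_le_two_or_mem_sublines hfix hM
  · intro B hB
    obtain ⟨M, hM, rfl⟩ := exists_zeroLocus_eq_of_mem_sublines hfix hB
    exact ⟨w M, hmem M, hwne M hM, himage M⟩

end Code

/-! ### Isomorphisms of incidence structures -/

namespace IncidenceStructure

lemma IsIso.trans {U V W : Type*} {d : U ≃ V} {e : V ≃ W} {C : IncidenceStructure U}
    {D : IncidenceStructure V} {E : IncidenceStructure W} (hd : IsIso d C D) (he : IsIso e D E) :
    IsIso (d.trans e) C E := by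
  unfold IsIso at *
  rw [← he, ← hd]
  ext T
  constructor
  · rintro ⟨B, hB, rfl⟩
    exact ⟨_, ⟨B, hB, rfl⟩, Set.image_comp e d B⟩
  · rintro ⟨_, ⟨B, hB, rfl⟩, rfl⟩
    exact ⟨B, hB, (Set.image_comp e d B).symm⟩

/-- Two structures on `W` that are isomorphic to `D` through the same bijection are equal. -/
lemma IsIso.eq_of_symm {V W : Type*} {e : V ≃ W} {D : IncidenceStructure V}
    {E E' : IncidenceStructure W} (h : IsIso e.symm E D) (h' : IsIso e D E') : E = E' := by
  have hblocks := h.trans h'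
  rw [Equiv.symm_trans_self] at hblocks
  cases E
  cases E'
  simpa [IsIso] using hblocks

end IncidenceStructure

/-! ### The minimum-support design -/

theorem mainTheorem2 {F K L : Type*} [Field F] [Field K] [Field L] [Algebra F K] [Algebra K L]
    (q : ℕ) (hq : q % 4 = 1)
    (hF : Nat.card F = q) (hK : Nat.card K = q ^ 2) (hL : Nat.card L = q ^ 4)
    (δ : L) (hδ : orderOf δ = 2 * (q ^ 2 + 1))
    (ω : L) (hω₀ : ω ≠ 0) (hω : ω ^ (q ^ 2) = -ω)
    (ζ : K) (hζ₀ : ζ ≠ 0) (hζ : ζ ^ q = -ζ)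
    (μ : F) (hμ : algebraMap F K μ = ζ ^ 2)
    (N : Submodule K (Fin (q ^ 2 + 1) → K))
    (hN : N = negacyclicCodeC K (q ^ 2 + 1) δ 1 (q ^ 2 + q + 1)) :
    -- the coordinate transport and the Cayley map are bijections onto the unit circle
    Set.BijOn (transport q (q ^ 2 + 1) δ) Set.univ (unitCircle L (q ^ 2 + 1)) ∧
    Set.BijOn (cayleyMap (K := K) ω) Set.univ (unitCircle L (q ^ 2 + 1)) ∧
    -- the minimum distance
    minDistance N = q ^ 2 - q ∧
    -- the minimum zero sets are the Cayley images of the Baer sublines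
    {T | ∃ Z ∈ minZeroSets N, T = transport q (q ^ 2 + 1) δ '' Z} =
      {T | ∃ B ∈ sublines F K, T = cayleyMap ω '' B} ∧
    -- the minimum supports are the complements of these images in the unit circle
    {T | ∃ S ∈ minSupports N, T = transport q (q ^ 2 + 1) δ '' S} =
      {T | ∃ B ∈ sublines F K, T = unitCircle L (q ^ 2 + 1) \ cayleyMap ω '' B} ∧
    -- the quadric is elliptic
    IsEllipticForm (ellipticForm μ) ∧
    -- the support design, the complement of the Miquelian plane, and the complements of the
    -- non-tangent plane sections
    (∃ (e : Fin (q ^ 2 + 1) ≃ OnePoint K) (f : OnePoint K ≃ quadric (ellipticForm μ)),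
      (∀ i, cayleyMap ω (e i) = transport q (q ^ 2 + 1) δ i) ∧
      (f OnePoint.infty).1.submodule = Submodule.span F {![0, 0, 0, 1]} ∧
      (∀ (t : K) (x y : F), t = algebraMap F K x + algebraMap F K y * ζ →
        ∃ s : F, algebraMap F K s = t ^ (q + 1) ∧
          (f (t : OnePoint K)).1.submodule = Submodule.span F {![1, x, y, s]}) ∧
      IncidenceStructure.IsIso e (minSupportDesign N) (miquelianPlane F K).complement ∧
      IncidenceStructure.IsIso f (miquelianPlane F K).complement
        (planeSectionStructure (ellipticForm μ)).complement ∧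
      IncidenceStructure.IsIso (e.trans f) (minSupportDesign N)
        (planeSectionStructure (ellipticForm μ)).complement) ∧
    -- these complements are also the minimum supports of the code of the quadric
    (∀ g : quadric (ellipticForm μ) → Fin 4 → F,
      (∀ P, P.1.submodule = Submodule.span F {g P}) →
      minSupportDesign (columnCode g) = (planeSectionStructure (ellipticForm μ)).complement) := by
  have hq0 : q ≠ 0 := by rintro rfl; simp at hq
  have hodd : Odd q := Nat.odd_iff.2 (by omega)
  have hfinF : Finite F := Nat.finite_of_card_ne_zero (by rwa [hF])
  have hfinK : Finite K := Nat.finite_of_card_ne_zero (by rw [hK]; exact pow_ne_zero _ hq0)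
  have hfinL : Finite L := Nat.finite_of_card_ne_zero (by rw [hL]; exact pow_ne_zero _ hq0)
  have hF2 : 2 ≤ Nat.card F := Finite.one_lt_card
  have h2 : (2 : L) ≠ 0 := two_ne_zero_of_odd_card (by rw [hL]; exact hodd.pow)
  have hKF : Nat.card K = Nat.card F ^ 2 := by rw [hK, hF]
  have hT := transport_bijOn hq hδ
  have hC : Set.BijOn (cayleyMap (K := K) ω) Set.univ (unitCircle L (q ^ 2 + 1)) := by
    rw [← hK] at hω ⊢
    exact cayleyMap_bijOn h2 hω₀ hω
  -- the two bijections onto the unit circle identify the coordinates with `PG(1, K)`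
  obtain ⟨e, he⟩ : ∃ e : Fin (q ^ 2 + 1) ≃ OnePoint K,
      ∀ i, cayleyMap ω (e i) = transport q (q ^ 2 + 1) δ i := by
    let eT := (Equiv.Set.univ _).symm.trans (hT.equiv _)
    let eC := (Equiv.Set.univ _).symm.trans (hC.equiv _)
    refine ⟨eT.trans eC.symm, fun i => ?_⟩
    exact congrArg Subtype.val (eC.apply_symm_apply (eT i))
  have hN' : HasSublineZeros F e N := by
    rw [hN]
    exact hasSublineZeros_negacyclicCodeC hq hF hK hL hδ hω₀ hω he
  have himage : ∀ S, transport q (q ^ 2 + 1) δ '' S = cayleyMap ω '' (e '' S) := by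
    intro S
    rw [Set.image_image]
    exact Set.image_congr fun i _ => (he i).symm
  have hcompl : ∀ B : Set (OnePoint K),
      cayleyMap ω '' Bᶜ = unitCircle L (q ^ 2 + 1) \ cayleyMap ω '' B := by
    intro B
    rw [← hC.image_eq, ← Set.image_sdiff (Set.injOn_univ.1 hC.injOn), Set.compl_eq_univ_sdiff]
  -- conjugation of `K` and coordinates on the quadric
  obtain ⟨σ', hσ'⟩ := exists_frobenius F K
  obtain ⟨σ, hσ⟩ : ∃ σ : K →+* K, ∀ x, σ x = x ^ Nat.card F := ⟨σ', hσ'⟩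
  obtain ⟨re, im, hc⟩ := exists_quadraticCoords (by rwa [hF]) hKF hσ hζ₀ (by rw [hσ, hF, hζ]) hμ
  have hnorm : ∀ c : F, ∃ s : K, s * σ s = algebraMap F K c := fun c => by
    simpa only [hσ] using exists_mul_pow_card_eq hKF c
  let f : OnePoint K ≃ quadric (ellipticForm μ) := Equiv.ofBijective _ hc.quadricPoint_bijective
  have hf : ∀ t, f t = quadricPoint μ re im t := fun t => rfl
  have hiso := hN'.isIso_miquelianPlane hF2
  have hisoQ := hc.isIso_planeSections hnorm hf
  refine ⟨hT, hC, ?_, ?_, ?_, hc.isEllipticForm, ⟨e, f, he, ?_, ?_, hiso, hisoQ, ?_⟩, ?_⟩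
  · rw [hN'.minDistance_eq hF2, hK, hF]
  · ext T
    constructor
    · rintro ⟨Z, hZ, rfl⟩
      exact ⟨e '' Z, (hN'.mem_minZeroSets_iff hF2).1 hZ, himage Z⟩
    · rintro ⟨B, hB, rfl⟩
      have h1 : e '' (e ⁻¹' B) = B := Set.image_preimage_eq _ e.surjective
      exact ⟨e ⁻¹' B, (hN'.mem_minZeroSets_iff hF2).2 (by rwa [h1]), by rw [himage, h1]⟩
  · ext T
    constructor
    · rintro ⟨S, hS, rfl⟩
      refine ⟨e '' Sᶜ, (hN'.mem_minSupports_iff hF2).1 hS, ?_⟩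
      rw [← hcompl, Set.image_compl_eq e.bijective, compl_compl, himage]
    · rintro ⟨B, hB, rfl⟩
      have h1 : e '' (e ⁻¹' B) = B := Set.image_preimage_eq _ e.surjective
      refine ⟨(e ⁻¹' B)ᶜ, (hN'.mem_minSupports_iff hF2).2 (by rwa [compl_compl, h1]), ?_⟩
      rw [himage, Set.image_compl_eq e.bijective, h1, hcompl]
  · rw [hf, submodule_quadricPoint, quadricVec_infty]
  · rintro t x y rfl
    refine ⟨x ^ 2 - μ * y ^ 2, ?_, ?_⟩
    · rw [← hc.mul_conj, hσ, hF, pow_succ, mul_comm]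
    · rw [hf, submodule_quadricPoint, quadricVec_coe, (hc.re_im_eq x y).1, (hc.re_im_eq x y).2]
  · exact hiso.trans hisoQ
  · intro g hg
    have hcode := (hc.hasSublineZeros_columnCode hf hg).isIso_miquelianPlane hF2
    exact hcode.eq_of_symm hisoQ
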